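/- Notation. Let $0<q<1$. For $t\in\mathbb C$, $m\in\mathbb N_0$ put $(t;q)_m=\prod_{i=0}^{m-1}(1-tq^i)$, $(t;q)_\infty=\prod_{i\ge 0}(1-tq^i)$, and $(t_1,\dots,t_r;q)_m=(t_1;q)_m\cdots(t_r;q)_m$ for $m\in\mathbb N_0\cup\{\infty\}$; a superscript $\pm$, as in $tz^{\pm}$, means that both $tz$ and $tz^{-1}$ occur in the list. Let $${}_4\phi_3\!\left({a_1,a_2,a_3,a_4\atop b_1,b_2,b_3};q,y\right)=\sum_{j\ge0}\frac{(a_1,a_2,a_3,a_4;q)_j}{(q,b_1,b_2,b_3;q)_j}\,y^j ,$$ where a series with $a_1=q^{-m}$, $m\in\mathbb N_0$, is understood to stop at $j=m$. For $x=\frac12(z+z^{-1})$ the Askey--Wilson polynomials are $$p_n(x;a,b,c,d|q)=a^{-n}(ab,ac,ad;q)_n\;{}_4\phi_3\!\left({q^{-n},q^{n-1}abcd,az,az^{-1}\atop ab,ac,ad};q,q\right)$$ (with the denominators $(ab,ac,ad;q)_j$, $0\le j\le n$, cancelled against the prefactor $(ab,ac,ad;q)_n$, so that $p_n$ is defined for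 all $b,c,d$), and $$w(x;a,b,c,d|q)=\frac{(z^{\pm2};q)_\infty}{(az^{\pm},bz^{\pm},cz^{\pm},dz^{\pm};q)_\infty}.$$ **Corollary.** Let $n,k\in\mathbb N_0$, $0<q<1$, and let $a,b,c,d,e,f\in\mathbb C\setminus\{0\}$ with $|a|,|b|,|c|,|f|<1$. Then the integral $$\mathcal I_{n,k}(a,b,c,d,e,f|q):=\int_{-1}^1 p_n(x;a,b,c,d|q)\,p_k(x;a,b,e,f|q)\,w(x;a,b,c,f|q)\,\frac{dx}{\sqrt{1-x^2}}$$ converges absolutely, and the following hold. (i) If $(cd;q)_n\neq0$, $(\frac ec;q)_k\ne0$ and $(q^{1-k}\frac ce;q)_n\neq0$, then $${}_4\phi_3\!\left({q^{-n},q^{n-1}abcd,cf,\frac{qc}{e}\atop cd,q^kabcf,q^{1-k}\frac ce};q,q\right)=c^{n-k}\,\frac{(q,cf,q^nac,q^nbc,q^kab,q^kaf,q^kbf;q)_\infty}{2\pi\,(cd;q)_n(\frac ec;q)_k(q^kabcf;q)_\infty}\;\mathcal I_{n,k}(a,b,c,d,e,f|q).$$ (ii) If $(ef;q)_k\neq0$,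 $(\frac df;q)_n\ne0$ and $(q^{1-n}\frac fd;q)_k\neq0$, then $${}_4\phi_3\!\left({q^{-k},q^{k-1}abef,cf,\frac{qf}{d}\atop ef,q^nabcf,q^{1-n}\frac fd};q,q\right)=f^{k-n}\,\frac{(q,cf,q^nab,q^nac,q^nbc,q^kaf,q^kbf;q)_\infty}{2\pi\,(\frac df;q)_n(ef;q)_k(q^nabcf;q)_\infty}\;\mathcal I_{n,k}(a,b,c,d,e,f|q).$$ -/

import Mathlib

open Filter Topology

noncomputable section

/-- The finite `q`-shifted factorial `(a; q)_n = (1 - a)(1 - a q) ⋯ (1 - a q ^ (n - 1))`. -/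
def qPoch (a q : ℂ) (n : ℕ) : ℂ := ∏ i ∈ Finset.range n, (1 - a * q ^ i)

/-- The infinite `q`-shifted factorial `(a; q)_∞`, for `|q| < 1`. -/
def qPochInf (a q : ℂ) : ℂ := ∏' i : ℕ, (1 - a * q ^ i)

/-- For `|q| < 1`, `(a; q)_∞` is the limit of `(a; q)_n`. -/
theorem qPochInf_tendsto (a q : ℂ) (hq : ‖q‖ < 1) :
    Tendsto (fun n => qPoch a q n) atTop (𝓝 (qPochInf a q)) := by
  have hs : Summable (fun i : ℕ => ‖-(a * q ^ i)‖) := by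
    simp only [norm_neg, norm_mul, norm_pow]
    exact (summable_geometric_of_lt_one (norm_nonneg _) hq).mul_left _
  have hm : Multipliable (fun i : ℕ => 1 - a * q ^ i) := by
    simpa [sub_eq_add_neg] using multipliable_one_add_of_summable hs
  exact hm.hasProd.tendsto_prod_nat

/-- The basic hypergeometric series
`₄φ₃ (a₁, a₂, a₃, a₄; b₁, b₂, b₃; q, z)`. -/
def phi43 (a₁ a₂ a₃ a₄ b₁ b₂ b₃ q z : ℂ) : ℂ :=
  ∑' j : ℕ, (qPoch a₁ q j * qPoch a₂ q j * qPoch a₃ q j * qPoch a₄ q j) /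
    (qPoch q q j * qPoch b₁ q j * qPoch b₂ q j * qPoch b₃ q j) * z ^ j

/-- The Askey--Wilson polynomial `p_n(x; a, b, c, d | q)`, `x = (z + z⁻¹) / 2`, as a function
of `z`. The denominators `(ab, ac, ad; q)_j` of the terminating `₄φ₃` are cancelled against the
prefactor `(ab, ac, ad; q)_n`, so that the polynomial is defined for all `b, c, d`;
see `askeyWilsonZ_eq`. -/
def askeyWilsonZ (n : ℕ) (z a b c d q : ℂ) : ℂ :=
  a ^ (-(n : ℤ)) * ∑ j ∈ Finset.range (n + 1),
    (qPoch (q ^ (-(n : ℤ))) q j * qPoch (q ^ ((n : ℤ) - 1) * a * b * c * d) q j *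
      qPoch (a * z) q j * qPoch (a * z⁻¹) q j) / qPoch q q j *
    (qPoch (a * b * q ^ j) q (n - j) * qPoch (a * c * q ^ j) q (n - j) *
      qPoch (a * d * q ^ j) q (n - j)) * q ^ j

/-- A solution `z` of `x = (z + z⁻¹) / 2`. The other one is its inverse. -/
def zOf (x : ℂ) : ℂ := x + (x ^ 2 - 1) ^ (1 / 2 : ℂ)

/-- The Askey--Wilson polynomial `p_n(x; a, b, c, d | q)`. -/
def askeyWilson (n : ℕ) (x a b c d q : ℂ) : ℂ := askeyWilsonZ n (zOf x) a b c d q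

/-- The Askey--Wilson weight `(z^{±2}; q)_∞ / (a z^±, b z^±, c z^±, d z^±; q)_∞`, as a function
of `z`. -/
def awWeightZ (z a b c d q : ℂ) : ℂ :=
  (qPochInf (z ^ 2) q * qPochInf (z⁻¹ ^ 2) q) /
    (qPochInf (a * z) q * qPochInf (a * z⁻¹) q * qPochInf (b * z) q * qPochInf (b * z⁻¹) q *
      qPochInf (c * z) q * qPochInf (c * z⁻¹) q * qPochInf (d * z) q * qPochInf (d * z⁻¹) q)

/-- The Askey--Wilson weight `w(x; a, b, c, d | q)`. -/
def awWeight (x a b c d q : ℂ) : ℂ := awWeightZ (zOf x) a b c d q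

/-- The integrand of `I_{n,k}(a, b, c, d, e, f | q)`. -/
def awIntegrand (n k : ℕ) (a b c d e f q : ℂ) (x : ℝ) : ℂ :=
  askeyWilson n x a b c d q * askeyWilson k x a b e f q * awWeight x a b c f q /
    (Real.sqrt (1 - x ^ 2) : ℂ)

/-- `I_{n,k}(a, b, c, d, e, f | q) =
∫_{-1}^1 p_n(x; a, b, c, d | q) p_k(x; a, b, e, f | q) w(x; a, b, c, f | q) dx / √(1 - x²)`. -/
def awIntegral (n k : ℕ) (a b c d e f q : ℂ) : ℂ :=
  ∫ x in (-1 : ℝ)..1, awIntegrand n k a b c d e f q x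

theorem qPoch_split (a q : ℂ) {j n : ℕ} (h : j ≤ n) :
    qPoch a q j * qPoch (a * q ^ j) q (n - j) = qPoch a q n := by
  obtain ⟨m, rfl⟩ := Nat.exists_eq_add_of_le h
  simp [qPoch, Finset.prod_range_add, pow_add, mul_assoc]

/-- Where the `₄φ₃` makes sense, `askeyWilsonZ` is the usual formula
`a^{-n} (ab, ac, ad; q)_n ₄φ₃ (q^{-n}, q^{n-1}abcd, a z, a z⁻¹; ab, ac, ad; q, q)`. -/
theorem askeyWilsonZ_eq (n : ℕ) (z a b c d q : ℂ) (hq : q ≠ 0)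
    (hb : qPoch (a * b) q n ≠ 0) (hc : qPoch (a * c) q n ≠ 0) (hd : qPoch (a * d) q n ≠ 0) :
    askeyWilsonZ n z a b c d q =
      a ^ (-(n : ℤ)) * (qPoch (a * b) q n * qPoch (a * c) q n * qPoch (a * d) q n) *
        phi43 (q ^ (-(n : ℤ))) (q ^ ((n : ℤ) - 1) * a * b * c * d) (a * z) (a * z⁻¹)
          (a * b) (a * c) (a * d) q q := by
  have h0 : ∀ j ∉ Finset.range (n + 1), qPoch (q ^ (-(n : ℤ))) q j = 0 := by
    intro j hj
    have hj' : n < j := by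
      rw [Finset.mem_range] at hj
      omega
    refine Finset.prod_eq_zero (Finset.mem_range.2 hj') ?_
    simp [hq]
  unfold askeyWilsonZ phi43
  rw [tsum_eq_sum (s := Finset.range (n + 1)) 
    (fun j hj => by rw [h0 j hj]; simp), mul_assoc (a ^ (-(n : ℤ))) _ (Finset.sum _ _),
    Finset.mul_sum _ _ (qPoch (a * b) q n * qPoch (a * c) q n * qPoch (a * d) q n)]
  congr 1
  refine Finset.sum_congr rfl fun j hj => ?_
  have hj' : j ≤ n := by simpa [Nat.lt_succ_iff] using hj
  rw [← qPoch_split (a * b) q hj'] at hb ⊢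
  rw [← qPoch_split (a * c) q hj'] at hc ⊢
  rw [← qPoch_split (a * d) q hj'] at hd ⊢
  have hb' := left_ne_zero_of_mul hb
  have hc' := left_ne_zero_of_mul hc
  have hd' := left_ne_zero_of_mul hd
  by_cases hQ : qPoch q q j = 0
  · simp [hQ]
  · field_simp

theorem askeyWilsonZ_inv (n : ℕ) (z a b c d q : ℂ) :
    askeyWilsonZ n z⁻¹ a b c d q = askeyWilsonZ n z a b c d q := by
  unfold askeyWilsonZ
  congr 1
  refine Finset.sum_congr rfl fun j _ => ?_
  rw [inv_inv]
  ring

theorem awWeightZ_inv (z a b c d q : ℂ) :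
    awWeightZ z⁻¹ a b c d q = awWeightZ z a b c d q := by
  unfold awWeightZ
  rw [inv_inv]
  rw [mul_comm (qPochInf (z⁻¹ ^ 2) q), mul_right_comm _ (qPochInf (d * z⁻¹) q)]
  rw [mul_comm (qPochInf (a * z⁻¹) q)]
  rw [mul_right_comm _ (qPochInf (b * z⁻¹) q), mul_right_comm _ (qPochInf (c * z⁻¹) q)]

theorem zOf_mul (x : ℂ) : zOf x * (x - (x ^ 2 - 1) ^ (1 / 2 : ℂ)) = 1 := by
  have h : ((x ^ 2 - 1) ^ (1 / 2 : ℂ)) ^ 2 = x ^ 2 - 1 := by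
    rw [one_div]
    simp
  unfold zOf
  linear_combination -h

theorem zOf_ne_zero (x : ℂ) : zOf x ≠ 0 := left_ne_zero_of_mul_eq_one (zOf_mul x)

theorem zOf_spec (x : ℂ) : x = (zOf x + (zOf x)⁻¹) / 2 := by
  rw [inv_eq_of_mul_eq_one_right (zOf_mul x)]
  unfold zOf
  ring

theorem zOf_eq (z : ℂ) (hz : z ≠ 0) :
    zOf ((z + z⁻¹) / 2) = z ∨ zOf ((z + z⁻¹) / 2) = z⁻¹ := by
  have h := zOf_spec ((z + z⁻¹) / 2)
  have h0 := zOf_ne_zero ((z + z⁻¹) / 2)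
  generalize zOf ((z + z⁻¹) / 2) = u at h h0
  have h1 : (u - z) * (u * z - 1) = 0 := by
    field_simp at h
    linear_combination -h
  rcases mul_eq_zero.1 h1 with h2 | h2
  · exact Or.inl (sub_eq_zero.1 h2)
  · exact Or.inr (eq_inv_of_mul_eq_one_left (sub_eq_zero.1 h2))

/-- `askeyWilson` at `x = (z + z⁻¹) / 2` is given by the formula in `z`, for either root. -/
theorem askeyWilson_eq (n : ℕ) (z a b c d q : ℂ) (hz : z ≠ 0) :
    askeyWilson n ((z + z⁻¹) / 2) a b c d q = askeyWilsonZ n z a b c d q := by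
  unfold askeyWilson
  rcases zOf_eq z hz with h | h <;> rw [h]
  exact askeyWilsonZ_inv n z a b c d q

/-- `awWeight` at `x = (z + z⁻¹) / 2` is given by the formula in `z`, for either root. -/
theorem awWeight_eq (z a b c d q : ℂ) (hz : z ≠ 0) :
    awWeight ((z + z⁻¹) / 2) a b c d q = awWeightZ z a b c d q := by
  unfold awWeight
  rcases zOf_eq z hz with h | h <;> rw [h]
  exact awWeightZ_inv z a b c d q

end

/-!
The substitution `x = cos θ` turns `awIntegral` into an average over the unit circle. The average
of the weight alone is the Askey–Wilson integral. It is evaluated from the recurrence in `a → a q`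
that shifting the contour by a factor `q` gives, which leaves the case `a = b = c = d = 0`.
As the weight absorbs the factors `(s z, s z⁻¹; q)_j`, expanding a polynomial in them reduces its
average to that evaluation. For `p_k(x; a, b, e, f)` against the weight with parameters
`a, b, f, c qʲ` the resulting sum is a `₃φ₂` summed by the `q`-Saalschütz formula. Since `p_n` is
symmetric in its parameters, `p_n(x; a, b, c, d)` may be expanded in `(c z, c z⁻¹; q)_j`, and its
coefficients become the terms of the `₄φ₃`. The second identity is the first one with `n ↔ k`,
`c ↔ f`, `d ↔ e`.
-/

noncomputable section

open Finset.HasAntidiagonal (antidiagonal mem_antidiagonal)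
open Real (circleAverage)
open Metric (sphere ball)

variable {q a b c d z : ℂ}

@[simp] theorem qPoch_zero (a q : ℂ) : qPoch a q 0 = 1 := by simp [qPoch]

theorem qPoch_succ (a q : ℂ) (n : ℕ) :
    qPoch a q (n + 1) = qPoch a q n * (1 - a * q ^ n) :=
  Finset.prod_range_succ _ n

theorem qPoch_add (a q : ℂ) (m n : ℕ) :
    qPoch a q (m + n) = qPoch a q m * qPoch (a * q ^ m) q n := by
  rw [← qPoch_split a q (Nat.le_add_right m n), Nat.add_sub_cancel_left]

theorem qPoch_succ' (a q : ℂ) (n : ℕ) :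
    qPoch a q (n + 1) = (1 - a) * qPoch (a * q) q n := by
  simpa [qPoch_succ] using (congrArg (qPoch a q) (add_comm n 1)).trans (qPoch_add a q 1 n)

theorem norm_mul_lt_one {s t : ℂ} (hs : ‖s‖ < 1) (ht : ‖t‖ ≤ 1) : ‖s * t‖ < 1 := by
  rw [norm_mul]
  exact mul_lt_one_of_nonneg_of_lt_one_left (norm_nonneg s) hs ht

theorem norm_mul_pow_lt_one (hq : ‖q‖ < 1) (ha : ‖a‖ < 1) (n : ℕ) : ‖a * q ^ n‖ < 1 :=
  norm_mul_lt_one ha (by simpa using pow_le_one₀ (norm_nonneg q) hq.le)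

theorem one_sub_mul_pow_ne_zero (hq : ‖q‖ < 1) (ha : ‖a‖ < 1) (n : ℕ) : 1 - a * q ^ n ≠ 0 :=
  sub_ne_zero.2 fun h => by simpa [← h] using norm_mul_pow_lt_one hq ha n

theorem qPoch_ne_zero (hq : ‖q‖ < 1) (ha : ‖a‖ < 1) (n : ℕ) : qPoch a q n ≠ 0 :=
  Finset.prod_ne_zero_iff.2 fun i _ => one_sub_mul_pow_ne_zero hq ha i

@[fun_prop]
theorem continuous_qPoch (q : ℂ) (n : ℕ) : Continuous fun a => qPoch a q n := by
  unfold qPoch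
  fun_prop

theorem qPoch_reverse {y t : ℂ} {n : ℕ} (hq0 : q ≠ 0) (h : y * t * q ^ n = q) :
    qPoch y q n = (-y) ^ n * q ^ n.choose 2 * qPoch t q n := by
  have hpow : q ^ n.choose 2 = ∏ i ∈ Finset.range n, q ^ (n - 1 - i) := by
    rw [Finset.prod_range_reflect (fun i => q ^ i) n, Finset.prod_pow_eq_pow_sum,
      Finset.sum_range_id, Nat.choose_two_right]
  have hconst : (-y) ^ n = ∏ _i ∈ Finset.range n, -y := by simp
  unfold qPoch
  rw [hpow, hconst, ← Finset.prod_mul_distrib, ← Finset.prod_mul_distrib,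
    ← Finset.prod_range_reflect]
  refine Finset.prod_congr rfl fun i hi => ?_
  obtain ⟨m, rfl⟩ : ∃ m, n = i + m + 1 :=
    ⟨n - i - 1, by have := Finset.mem_range.1 hi; omega⟩
  rw [show i + m + 1 - 1 - i = m by omega]
  have hyt : y * t * q ^ (i + m) = 1 := by
    apply mul_right_cancel₀ hq0
    linear_combination h
  linear_combination -hyt + y * t * pow_add q i m

/-- The two ways of splitting `(y q⁻ʲ; q)_{j+k}`, with the blocks of length `j` reversed. -/
theorem qPoch_div_pow {y : ℂ} (hq0 : q ≠ 0) (hy : y ≠ 0) (j k : ℕ) :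
    qPoch (y / q ^ j) q k * qPoch (q / (y * q ^ k)) q j * (q ^ j) ^ k =
      qPoch y q k * qPoch (q / y) q j := by
  have hsplit : qPoch (y / q ^ j) q j * qPoch y q k =
      qPoch (y / q ^ j) q k * qPoch (y / q ^ j * q ^ k) q j := by
    rw [← qPoch_add, add_comm k j, qPoch_add, div_mul_cancel₀ _ (pow_ne_zero j hq0)]
  rw [qPoch_reverse (y := y / q ^ j) (t := q / y) hq0 (by field_simp),
    qPoch_reverse (y := y / q ^ j * q ^ k) (t := q / (y * q ^ k)) hq0 (by field_simp)] at hsplit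
  have hne : (-(y / q ^ j)) ^ j * q ^ j.choose 2 ≠ 0 := by
    simp [hq0, hy]
  apply mul_left_cancel₀ hne
  rw [← neg_mul, mul_pow, pow_right_comm q k j] at hsplit
  linear_combination -hsplit

theorem multipliable_one_sub_mul_pow (hq : ‖q‖ < 1) (a : ℂ) :
    Multipliable fun i : ℕ => 1 - a * q ^ i := by
  simpa [sub_eq_add_neg] using multipliable_one_add_of_summable
    (f := fun i : ℕ => -(a * q ^ i)) (by
      simpa using (summable_geometric_of_lt_one (norm_nonneg q) hq).mul_left ‖a‖)

@[simp] theorem qPochInf_zero (q : ℂ) : qPochInf 0 q = 1 := by simp [qPochInf]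

theorem qPochInf_eq_qPoch_mul (hq : ‖q‖ < 1) (a : ℂ) (n : ℕ) :
    qPochInf a q = qPoch a q n * qPochInf (a * q ^ n) q := by
  have h := (qPochInf_tendsto (a * q ^ n) q hq).const_mul (qPoch a q n)
  simp only [← qPoch_add, add_comm n] at h
  exact tendsto_nhds_unique ((tendsto_add_atTop_iff_nat n).2 (qPochInf_tendsto a q hq)) h

theorem qPochInf_eq_one_sub_mul (hq : ‖q‖ < 1) (a : ℂ) :
    qPochInf a q = (1 - a) * qPochInf (a * q) q := by
  simpa [qPoch] using qPochInf_eq_qPoch_mul hq a 1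

theorem qPochInf_ne_zero (hq : ‖q‖ < 1) (ha : ‖a‖ < 1) : qPochInf a q ≠ 0 := by
  have h := tprod_one_add_ne_zero_of_summable (f := fun i : ℕ => -(a * q ^ i))
    (fun i => by simpa [sub_eq_add_neg] using one_sub_mul_pow_ne_zero hq ha i)
    (by simpa using (summable_geometric_of_lt_one (norm_nonneg q) hq).mul_left ‖a‖)
  simpa [qPochInf, sub_eq_add_neg] using h

@[fun_prop]
theorem differentiable_qPochInf (hq : ‖q‖ < 1) : Differentiable ℂ fun a => qPochInf a q := by
  intro a
  have hsum : Summable fun i : ℕ => (‖a‖ + 1) * ‖q‖ ^ i :=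
    (summable_geometric_of_lt_one (norm_nonneg q) hq).mul_left _
  have hprod := hsum.hasProdLocallyUniformlyOn_nat_one_add (K := Metric.ball (0 : ℂ) (‖a‖ + 1))
    (f := fun i x => -(x * q ^ i)) Metric.isOpen_ball
    (.of_forall fun n x hx => by
      rw [norm_neg, norm_mul, norm_pow]
      have : ‖x‖ < ‖a‖ + 1 := by simpa using hx
      gcongr) (fun _ => by fun_prop)
  have hdiff := hprod.differentiableOn (.of_forall fun _ => by
    simpa [Finset.prod_fn] using DifferentiableOn.finsetProd (fun _ _ => by fun_prop))
    Metric.isOpen_ball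
  simpa [qPochInf, sub_eq_add_neg] using
    (hdiff a (by simp)).differentiableAt (Metric.isOpen_ball.mem_nhds (by simp))

@[fun_prop]
theorem continuous_qPochInf (hq : ‖q‖ < 1) : Continuous fun a => qPochInf a q :=
  (differentiable_qPochInf hq).continuous

theorem norm_sq_lt_one (hq : ‖q‖ < 1) : ‖q ^ 2‖ < 1 := by
  rw [norm_pow]
  exact pow_lt_one₀ (norm_nonneg q) hq two_ne_zero

theorem qPochInf_sq (hq : ‖q‖ < 1) (x : ℂ) :
    qPochInf (x ^ 2) (q ^ 2) = qPochInf x q * qPochInf (-x) q := by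
  unfold qPochInf
  rw [← (multipliable_one_sub_mul_pow hq x).tprod_mul (multipliable_one_sub_mul_pow hq (-x))]
  congr 1 with i
  ring

theorem qPochInf_even_mul_odd (hq : ‖q‖ < 1) (x : ℂ) :
    qPochInf x q = qPochInf x (q ^ 2) * qPochInf (x * q) (q ^ 2) := by
  have heven : (fun i : ℕ => 1 - x * (q ^ 2) ^ i) = fun i => 1 - x * q ^ (2 * i) := by
    simp only [pow_mul]
  have hodd : (fun i : ℕ => 1 - x * q * (q ^ 2) ^ i) = fun i => 1 - x * q ^ (2 * i + 1) := by
    simp only [pow_succ, pow_mul, mul_assoc, mul_comm q]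
  have meven := multipliable_one_sub_mul_pow (norm_sq_lt_one hq) x
  have modd := multipliable_one_sub_mul_pow (norm_sq_lt_one hq) (x * q)
  unfold qPochInf
  rw [heven] at meven ⊢
  rw [hodd] at modd ⊢
  exact (tprod_even_mul_odd (f := fun i => 1 - x * q ^ i) meven modd).symm

theorem qPochInf_neg_mul_qPochInf_sq (hq : ‖q‖ < 1) :
    qPochInf (-q) q * qPochInf q (q ^ 2) = 1 := by
  have hsq := qPochInf_sq hq q
  have hsplit := qPochInf_even_mul_odd hq q
  rw [← sq q] at hsplit
  apply mul_left_cancel₀ (qPochInf_ne_zero hq hq)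
  linear_combination -qPochInf q (q ^ 2) * hsq - hsplit

theorem sum_antidiagonal_succ_eq_of_recurrence {M : Type*} [AddCommMonoid M] {F X Y : ℕ → ℕ → M}
    (hleft : ∀ m, F 0 (m + 1) = Y 0 m) (hright : ∀ i, F (i + 1) 0 = X i 0)
    (hstep : ∀ i m, F (i + 1) (m + 1) = X i (m + 1) + Y (i + 1) m) (n : ℕ) :
    ∑ p ∈ antidiagonal (n + 1), F p.1 p.2 = ∑ p ∈ antidiagonal n, (X p.1 p.2 + Y p.1 p.2) := by
  cases n with
  | zero => simp [Finset.Nat.antidiagonal_succ, hleft, hright, add_comm]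
  | succ n =>
    rw [Finset.sum_add_distrib, Finset.Nat.sum_antidiagonal_succ' (f := fun p => X p.1 p.2),
      Finset.Nat.sum_antidiagonal_succ (f := fun p => Y p.1 p.2),
      Finset.Nat.antidiagonal_succ_succ', Finset.sum_cons, Finset.sum_cons, Finset.sum_map]
    simp only [Function.Embedding.prodMap, Function.Embedding.coeFn_mk, Prod.map_fst, Prod.map_snd,
      Nat.succ_eq_add_one, hstep, hleft, hright, Finset.sum_add_distrib]
    abel

/-- The Gaussian binomial coefficient `[i + m choose i]_q`, as a function of the pair `(i, m)`. -/
def qChoose (q : ℂ) (i m : ℕ) : ℂ := qPoch q q (i + m) / (qPoch q q i * qPoch q q m)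

theorem qChoose_zero_left (hq : ‖q‖ < 1) (m : ℕ) : qChoose q 0 m = 1 := by
  simp [qChoose, div_self (qPoch_ne_zero hq hq m)]

theorem qChoose_zero_right (hq : ‖q‖ < 1) (i : ℕ) : qChoose q i 0 = 1 := by
  simp [qChoose, div_self (qPoch_ne_zero hq hq i)]

/-- For `t = 0` this is the `q`-Pascal rule. -/
theorem qChoose_succ_succ_mul (hq : ‖q‖ < 1) (i m : ℕ) (t : ℂ) :
    qChoose q (i + 1) (m + 1) * (1 - t * q ^ (i + m + 1)) =
      q ^ (m + 1) * qChoose q i (m + 1) * (1 - t * q ^ i) +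
        qChoose q (i + 1) m * (1 - t * q ^ (2 * i + m + 2)) := by
  have hi := qPoch_ne_zero hq hq i
  have hm := qPoch_ne_zero hq hq m
  have hi' := one_sub_mul_pow_ne_zero hq hq i
  have hm' := one_sub_mul_pow_ne_zero hq hq m
  simp only [qChoose, ← add_assoc, add_right_comm i 1 m, qPoch_succ, pow_succ, pow_add, pow_mul',
    pow_zero, one_mul] at *
  field_simp
  ring

/-- A polynomial form of the `q`-Pfaff–Saalschütz sum. -/
theorem qPoch_mul_qPoch_eq_sum_antidiagonal (hq : ‖q‖ < 1) (s A B : ℂ) (n : ℕ) :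
    qPoch (s * A) q n * qPoch (s * B) q n =
      ∑ p ∈ antidiagonal n, qChoose q p.1 p.2 * s ^ p.1 *
        qPoch (s * A * B * q ^ p.1) q p.2 * qPoch s q p.2 * (qPoch A q p.1 * qPoch B q p.1) := by
  induction n with
  | zero => simp [qChoose]
  | succ n ih =>
    let K : ℕ → ℕ → ℂ := fun i m =>
      qChoose q i m * s ^ i * qPoch (s * A * B * q ^ i) q m * qPoch s q m
    let X : ℕ → ℕ → ℂ := fun i m =>
      K i m * (s * q ^ m) * (qPoch A q (i + 1) * qPoch B q (i + 1))
    let Y : ℕ → ℕ → ℂ := fun i m =>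
      K i m * ((1 - s * q ^ m) * (1 - s * A * B * q ^ (2 * i + m))) * (qPoch A q i * qPoch B q i)
    have hfactor : ∀ p ∈ antidiagonal n,
        K p.1 p.2 * (qPoch A q p.1 * qPoch B q p.1) *
          ((1 - s * A * q ^ n) * (1 - s * B * q ^ n)) = X p.1 p.2 + Y p.1 p.2 := by
      rintro ⟨i, m⟩ hp
      obtain rfl : i + m = n := mem_antidiagonal.1 hp
      simp only [X, Y, qPoch_succ]
      ring
    rw [qPoch_succ, qPoch_succ, mul_mul_mul_comm, ih, Finset.sum_mul,
      Finset.sum_congr rfl hfactor]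
    refine (sum_antidiagonal_succ_eq_of_recurrence
      (F := fun i m => K i m * (qPoch A q i * qPoch B q i)) (fun m => ?_) (fun i => ?_)
      (fun i m => ?_) n).symm
    · simp only [K, Y, qChoose_zero_left hq, qPoch_succ, qPoch_zero]
      ring
    · simp only [K, X, qChoose_zero_right hq, qPoch_succ, qPoch_zero]
      ring
    · have hpascal := qChoose_succ_succ_mul hq i m (s * A * B)
      have hshift : s * A * B * q ^ i * q = s * A * B * q ^ (i + 1) := by ring
      simp only [K, X, Y]
      rw [qPoch_succ' (s * A * B * q ^ i), hshift, qPoch_succ (s * A * B * q ^ (i + 1)),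
        qPoch_succ s]
      linear_combination (s ^ (i + 1) * qPoch (s * A * B * q ^ (i + 1)) q m * qPoch s q m *
        (1 - s * q ^ m) * (qPoch A q (i + 1) * qPoch B q (i + 1))) * hpascal

theorem sum_antidiagonal_assoc {M : Type*} [AddCommMonoid M] (F : ℕ → ℕ → ℕ → M) (n : ℕ) :
    ∑ p ∈ antidiagonal n, ∑ r ∈ antidiagonal p.1, F r.1 r.2 p.2 =
      ∑ p ∈ antidiagonal n, ∑ r ∈ antidiagonal p.2, F p.1 r.1 r.2 := by
  rw [Finset.sum_sigma', Finset.sum_sigma']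
  refine Finset.sum_nbij' (fun x => ⟨(x.2.1, x.2.2 + x.1.2), (x.2.2, x.1.2)⟩)
    (fun x => ⟨(x.1.1 + x.2.1, x.2.2), (x.1.1, x.2.1)⟩) ?_ ?_ ?_ ?_ ?_ <;>
    rintro ⟨⟨i, m⟩, ⟨j, l⟩⟩ h <;>
    simp only [Finset.mem_sigma, mem_antidiagonal] at h ⊢ <;>
    obtain ⟨rfl, rfl⟩ := h <;> simp [add_assoc]

/-- The coefficient `(q⁻ⁿ; q)_j / (q; q)_j qʲ`, where `n = j + l`, of a terminating basic
hypergeometric series with argument `q`. -/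
def terminatingCoeff (q : ℂ) (j l : ℕ) : ℂ :=
  qPoch (q ^ (-((j + l : ℕ) : ℤ))) q j / qPoch q q j * q ^ j

theorem terminatingCoeff_eq_qChoose (hq0 : q ≠ 0) (hq : ‖q‖ < 1) (j l : ℕ) :
    terminatingCoeff q j l =
      qChoose q j l * ((-1) ^ j * q ^ j.choose 2 * q ^ j / (q ^ (j + l)) ^ j) := by
  have hj := qPoch_ne_zero hq hq j
  have hl := qPoch_ne_zero hq hq l
  rw [terminatingCoeff, qChoose, zpow_neg, zpow_natCast,
    qPoch_reverse (t := q * q ^ l) hq0 (by field_simp; ring), add_comm j l, qPoch_add, neg_pow,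
    inv_pow]
  field_simp

theorem terminatingCoeff_add_mul_qChoose (hq0 : q ≠ 0) (hq : ‖q‖ < 1) (i m l : ℕ) :
    terminatingCoeff q (i + m) l * qChoose q i m =
      terminatingCoeff q i (m + l) * terminatingCoeff q m l := by
  have hi := qPoch_ne_zero hq hq i
  have hm := qPoch_ne_zero hq hq m
  have him := qPoch_ne_zero hq hq (i + m)
  have hshift : q ^ (-((i + m + l : ℕ) : ℤ)) * q ^ i = q ^ (-((m + l : ℕ) : ℤ)) := by
    rw [add_assoc i, zpow_neg, zpow_neg, zpow_natCast, zpow_natCast, pow_add q i]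
    field_simp
  rw [terminatingCoeff, terminatingCoeff, terminatingCoeff, qChoose, qPoch_add _ q i m, hshift,
    ← add_assoc]
  field_simp
  ring

theorem choose_two_add (j l : ℕ) : (j + l).choose 2 = j.choose 2 + l.choose 2 + j * l := by
  rw [Nat.add_choose_eq]
  simp [Finset.Nat.antidiagonal_succ]
  ring

theorem sum_terminatingCoeff_saalschutz_of_ne_zero (hq0 : q ≠ 0) (hq : ‖q‖ < 1) {A B α β : ℂ}
    (n : ℕ) (hA : A ≠ 0) (hβ : β ≠ 0) (hB : B * q = A * α * β * q ^ n) :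
    ∑ p ∈ antidiagonal n, terminatingCoeff q p.1 p.2 * (qPoch A q p.1 * qPoch B q p.1) *
      (qPoch (A * α * q ^ p.1) q p.2 * qPoch (A * β * q ^ p.1) q p.2) =
    A ^ n * (qPoch α q n * qPoch β q n) := by
  obtain ⟨s, hs⟩ : ∃ s, s = q / (A * β * q ^ n) := ⟨_, rfl⟩
  have hsA : β * (s * A) * q ^ n = q := by rw [hs]; field_simp
  have hsB : s * B = α := by
    apply mul_right_cancel₀ hq0
    rw [mul_assoc, hB, hs]
    field_simp
  have hpfaff := qPoch_mul_qPoch_eq_sum_antidiagonal hq s A B n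
  rw [hsB] at hpfaff
  calc _ = ∑ p ∈ antidiagonal n, A ^ n * ((-β) ^ n * q ^ n.choose 2) *
        (qChoose q p.1 p.2 * s ^ p.1 * qPoch (s * A * B * q ^ p.1) q p.2 * qPoch s q p.2 *
          (qPoch A q p.1 * qPoch B q p.1)) := by
        refine Finset.sum_congr rfl ?_
        rintro ⟨j, l⟩ hp
        obtain rfl : j + l = n := mem_antidiagonal.1 hp
        have hrev : qPoch (A * β * q ^ j) q l =
            (-(A * β * q ^ j)) ^ l * q ^ l.choose 2 * qPoch s q l :=
          qPoch_reverse hq0 (by rw [hs, pow_add]; field_simp)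
        have hsj : s ^ j = q ^ j / ((A * β) ^ j * (q ^ (j + l)) ^ j) := by
          rw [hs, div_pow, mul_pow (A * β)]
        dsimp only
        rw [mul_right_comm s, hsB, mul_comm α, terminatingCoeff_eq_qChoose hq0 hq, hrev,
          choose_two_add, hsj, neg_pow, neg_pow β]
        field_simp
        ring
    _ = A ^ n * (qPoch α q n * qPoch β q n) := by
        rw [← Finset.mul_sum, ← hpfaff, qPoch_reverse hq0 hsA]
        ring

/-- The `q`-Pfaff–Saalschütz sum with the denominators cleared; the case `β = 0` follows by
continuity in `β`. -/
theorem sum_terminatingCoeff_saalschutz (hq0 : q ≠ 0) (hq : ‖q‖ < 1) {A B α β : ℂ} (n : ℕ)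
    (hA : A ≠ 0) (hB : B * q = A * α * β * q ^ n) :
    ∑ p ∈ antidiagonal n, terminatingCoeff q p.1 p.2 * (qPoch A q p.1 * qPoch B q p.1) *
      (qPoch (A * α * q ^ p.1) q p.2 * qPoch (A * β * q ^ p.1) q p.2) =
    A ^ n * (qPoch α q n * qPoch β q n) := by
  obtain rfl : B = A * α * β * q ^ n / q := eq_div_of_mul_eq hq0 hB
  refine congrFun (Continuous.ext_on (dense_compl_singleton (0 : ℂ))
    (f := fun β => ∑ p ∈ antidiagonal n, terminatingCoeff q p.1 p.2 *
      (qPoch A q p.1 * qPoch (A * α * β * q ^ n / q) q p.1) *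
      (qPoch (A * α * q ^ p.1) q p.2 * qPoch (A * β * q ^ p.1) q p.2))
    (g := fun β => A ^ n * (qPoch α q n * qPoch β q n)) (by fun_prop) (by fun_prop) ?_) β
  exact fun β hβ => sum_terminatingCoeff_saalschutz_of_ne_zero hq0 hq n hA hβ
    (div_mul_cancel₀ _ hq0)

theorem phi43_eq_sum_antidiagonal (hq0 : q ≠ 0) (n : ℕ) (a₂ a₃ a₄ b₁ b₂ b₃ : ℂ) :
    phi43 (q ^ (-(n : ℤ))) a₂ a₃ a₄ b₁ b₂ b₃ q q =
      ∑ p ∈ antidiagonal n, terminatingCoeff q p.1 p.2 *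
        (qPoch a₂ q p.1 * qPoch a₃ q p.1 * qPoch a₄ q p.1 /
          (qPoch b₁ q p.1 * qPoch b₂ q p.1 * qPoch b₃ q p.1)) := by
  have hvanish : ∀ j ∉ Finset.range (n + 1), qPoch (q ^ (-(n : ℤ))) q j = 0 := fun j hj =>
    Finset.prod_eq_zero (i := n) (by simpa [Nat.succ_le_iff] using hj) (by simp [hq0])
  rw [phi43, tsum_eq_sum (s := Finset.range (n + 1)) fun j hj => by rw [hvanish j hj]; simp,
    ← Finset.Nat.sum_antidiagonal_eq_sum_range_succ_mk
      (fun p => qPoch (q ^ (-(n : ℤ))) q p.1 * qPoch a₂ q p.1 * qPoch a₃ q p.1 * qPoch a₄ q p.1 /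
        (qPoch q q p.1 * qPoch b₁ q p.1 * qPoch b₂ q p.1 * qPoch b₃ q p.1) * q ^ p.1)]
  refine Finset.sum_congr rfl ?_
  rintro ⟨j, l⟩ hp
  obtain rfl : j + l = n := mem_antidiagonal.1 hp
  rw [terminatingCoeff]
  ring

/-- The product `(s z, s z⁻¹; q)_n`. -/
def qPochPair (s z q : ℂ) (n : ℕ) : ℂ := qPoch (s * z) q n * qPoch (s * z⁻¹) q n

/-- The coefficient of `(a z, a z⁻¹; q)_j` in `aⁿ p_n(x; a, b, c, d | q)`, where `n = j + l`. -/
def awCoeff (q a b c d : ℂ) (j l : ℕ) : ℂ :=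
  terminatingCoeff q j l * qPoch (q ^ (((j + l : ℕ) : ℤ) - 1) * a * b * c * d) q j *
    (qPoch (a * b * q ^ j) q l * qPoch (a * c * q ^ j) q l * qPoch (a * d * q ^ j) q l)

theorem askeyWilsonZ_eq_sum_antidiagonal (n : ℕ) (z a b c d q : ℂ) :
    askeyWilsonZ n z a b c d q =
      (a ^ n)⁻¹ * ∑ p ∈ antidiagonal n, awCoeff q a b c d p.1 p.2 * qPochPair a z q p.1 := by
  rw [askeyWilsonZ, zpow_neg, zpow_natCast, Finset.Nat.sum_antidiagonal_eq_sum_range_succ_mk]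
  congr 1
  refine Finset.sum_congr rfl fun j hj => ?_
  simp only [awCoeff, qPochPair, terminatingCoeff,
    Nat.add_sub_cancel' (Nat.lt_succ_iff.1 (Finset.mem_range.1 hj))]
  ring

theorem qPochPair_eq_sum_antidiagonal (hq : ‖q‖ < 1) (hc : c ≠ 0) (hz : z ≠ 0) (j : ℕ) :
    qPochPair a z q j = ∑ p ∈ antidiagonal j, qChoose q p.1 p.2 * (a / c) ^ p.1 *
      qPoch (a * c * q ^ p.1) q p.2 * qPoch (a / c) q p.2 * qPochPair c z q p.1 := by
  have h := qPoch_mul_qPoch_eq_sum_antidiagonal hq (a / c) (c * z) (c * z⁻¹) j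
  rwa [show a / c * (c * z) = a * z by field_simp,
    show a / c * (c * z⁻¹) = a * z⁻¹ by field_simp,
    show a * z * (c * z⁻¹) = a * c by field_simp] at h

theorem sum_awCoeff_mul_qChoose (hq0 : q ≠ 0) (hq : ‖q‖ < 1) (b d : ℂ) (ha : a ≠ 0)
    (hc : c ≠ 0) (i r : ℕ) :
    ∑ p ∈ antidiagonal r, awCoeff q a b c d (i + p.1) p.2 *
      (qChoose q i p.1 * (a / c) ^ i * qPoch (a * c * q ^ i) q p.1 * qPoch (a / c) q p.1) =
    (a / c) ^ (i + r) * awCoeff q c b a d i r := by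
  obtain ⟨T, hT⟩ : ∃ T, T = q ^ (((i + r : ℕ) : ℤ) - 1) * a * b * c * d := ⟨_, rfl⟩
  have hsaal := sum_terminatingCoeff_saalschutz hq0 hq (A := a / c) (B := T * q ^ i)
    (α := c * b * q ^ i) (β := c * d * q ^ i) r (div_ne_zero ha hc) (by
      rw [hT, zpow_sub_one₀ hq0, zpow_natCast, pow_add]
      field_simp)
  calc _ = ∑ p ∈ antidiagonal r, terminatingCoeff q i r * qPoch T q i * (a / c) ^ i *
        qPoch (a * c * q ^ i) q r * (terminatingCoeff q p.1 p.2 *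
          (qPoch (a / c) q p.1 * qPoch (T * q ^ i) q p.1) *
          (qPoch (a / c * (c * b * q ^ i) * q ^ p.1) q p.2 *
            qPoch (a / c * (c * d * q ^ i) * q ^ p.1) q p.2)) := by
        refine Finset.sum_congr rfl ?_
        rintro ⟨m, l⟩ hp
        obtain rfl : m + l = r := mem_antidiagonal.1 hp
        have hcoeff := terminatingCoeff_add_mul_qChoose hq0 hq i m l
        have hb : a / c * (c * b * q ^ i) * q ^ m = a * b * q ^ (i + m) := by field_simp; ring
        have hd : a / c * (c * d * q ^ i) * q ^ m = a * d * q ^ (i + m) := by field_simp; ring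
        have hac : a * c * q ^ i * q ^ m = a * c * q ^ (i + m) := by ring
        simp only [awCoeff, add_assoc i m l]
        rw [← hT, qPoch_add T q i m, qPoch_add (a * c * q ^ i) q m l, hb, hd, hac]
        linear_combination (qPoch T q i * qPoch (T * q ^ i) q m *
          (qPoch (a * b * q ^ (i + m)) q l * qPoch (a * c * q ^ (i + m)) q l *
            qPoch (a * d * q ^ (i + m)) q l) * (a / c) ^ i * qPoch (a * c * q ^ i) q m *
          qPoch (a / c) q m) * hcoeff
    _ = (a / c) ^ (i + r) * awCoeff q c b a d i r := by
        rw [← Finset.mul_sum, hsaal, awCoeff, hT, mul_comm c a]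
        ring_nf

theorem askeyWilsonZ_swap (hq0 : q ≠ 0) (hq : ‖q‖ < 1) (n : ℕ) (b d : ℂ) (hz : z ≠ 0)
    (ha : a ≠ 0) (hc : c ≠ 0) :
    askeyWilsonZ n z a b c d q = askeyWilsonZ n z c b a d q := by
  let F : ℕ → ℕ → ℕ → ℂ := fun i m l => awCoeff q a b c d (i + m) l *
    (qChoose q i m * (a / c) ^ i * qPoch (a * c * q ^ i) q m * qPoch (a / c) q m) *
      qPochPair c z q i
  calc askeyWilsonZ n z a b c d q
      = (a ^ n)⁻¹ * ∑ p ∈ antidiagonal n, ∑ r ∈ antidiagonal p.1, F r.1 r.2 p.2 := by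
        rw [askeyWilsonZ_eq_sum_antidiagonal]
        refine congrArg _ (Finset.sum_congr rfl fun p _ => ?_)
        rw [qPochPair_eq_sum_antidiagonal hq hc hz, Finset.mul_sum]
        refine Finset.sum_congr rfl fun r hr => ?_
        simp only [F, mem_antidiagonal.1 hr]
        ring
    _ = (a ^ n)⁻¹ * ∑ p ∈ antidiagonal n,
          (a / c) ^ n * (awCoeff q c b a d p.1 p.2 * qPochPair c z q p.1) := by
        rw [sum_antidiagonal_assoc]
        refine congrArg _ (Finset.sum_congr rfl fun p hp => ?_)
        rw [← Finset.sum_mul, sum_awCoeff_mul_qChoose hq0 hq b d ha hc, mem_antidiagonal.1 hp,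
          mul_assoc]
    _ = askeyWilsonZ n z c b a d q := by
        rw [askeyWilsonZ_eq_sum_antidiagonal, ← Finset.mul_sum, div_pow]
        field_simp

theorem askeyWilsonZ_swap_last (n : ℕ) (z a b c d q : ℂ) :
    askeyWilsonZ n z a b c d q = askeyWilsonZ n z a b d c q := by
  simp only [askeyWilsonZ, mul_right_comm _ c d]
  congr! 4
  ring

/-- The product `(s z, s z⁻¹; q)_∞`; the denominator of the Askey–Wilson weight consists of four
such factors. -/
def qPochInfPair (s z q : ℂ) : ℂ := qPochInf (s * z) q * qPochInf (s * z⁻¹) q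

theorem qPochInfPair_inv (s z q : ℂ) : qPochInfPair s z⁻¹ q = qPochInfPair s z q := by
  rw [qPochInfPair, qPochInfPair, inv_inv, mul_comm]

theorem qPochInfPair_ne_zero (hq : ‖q‖ < 1) (ha : ‖a‖ < 1) (hz : ‖z‖ = 1) :
    qPochInfPair a z q ≠ 0 :=
  mul_ne_zero (qPochInf_ne_zero hq (norm_mul_lt_one ha hz.le))
    (qPochInf_ne_zero hq (norm_mul_lt_one ha (by simp [hz])))

theorem qPochPair_ne_zero (hq : ‖q‖ < 1) (ha : ‖a‖ < 1) (hz : ‖z‖ = 1) (n : ℕ) :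
    qPochPair a z q n ≠ 0 :=
  mul_ne_zero (qPoch_ne_zero hq (norm_mul_lt_one ha hz.le) n)
    (qPoch_ne_zero hq (norm_mul_lt_one ha (by simp [hz])) n)

theorem qPochInfPair_eq_mul (hq : ‖q‖ < 1) (s z : ℂ) (n : ℕ) :
    qPochInfPair s z q = qPochPair s z q n * qPochInfPair (s * q ^ n) z q := by
  rw [qPochInfPair, qPochInf_eq_qPoch_mul hq (s * z) n, qPochInf_eq_qPoch_mul hq (s * z⁻¹) n,
    qPochPair, qPochInfPair, mul_right_comm s z, mul_right_comm s z⁻¹]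
  ring

theorem continuous_qPochInfPair {X : Type*} [TopologicalSpace X] {s z : X → ℂ} (hq : ‖q‖ < 1)
    (hs : Continuous s) (hz : Continuous z) (hz0 : ∀ x, z x ≠ 0) :
    Continuous fun x => qPochInfPair (s x) (z x) q := by
  unfold qPochInfPair
  fun_prop (disch := assumption)

theorem awWeightZ_eq_div_qPochInfPair (z a b c d q : ℂ) :
    awWeightZ z a b c d q = qPochInf (z ^ 2) q * qPochInf (z⁻¹ ^ 2) q /
      (qPochInfPair a z q * qPochInfPair b z q * qPochInfPair c z q * qPochInfPair d z q) := by
  simp only [awWeightZ, qPochInfPair, mul_assoc]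

theorem awWeightZ_rotate (z a b c d q : ℂ) : awWeightZ z a b c d q = awWeightZ z b c d a q := by
  simp only [awWeightZ_eq_div_qPochInfPair]
  ring_nf

theorem awWeightZ_swap (z a b c d q : ℂ) : awWeightZ z a b c d q = awWeightZ z a b d c q := by
  simp only [awWeightZ_eq_div_qPochInfPair]
  ring_nf

theorem awWeightZ_mul_pow (hq : ‖q‖ < 1) (ha : ‖a‖ < 1) (hz : ‖z‖ = 1) (b c d : ℂ) (n : ℕ) :
    awWeightZ z (a * q ^ n) b c d q = qPochPair a z q n * awWeightZ z a b c d q := by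
  have hne := qPochPair_ne_zero hq ha hz n
  rw [awWeightZ_eq_div_qPochInfPair, awWeightZ_eq_div_qPochInfPair,
    qPochInfPair_eq_mul hq a z n]
  field_simp

theorem continuous_awWeightZ {X : Type*} [TopologicalSpace X] {a z : X → ℂ} (hq : ‖q‖ < 1)
    (ha : Continuous a) (hz : Continuous z) (ha1 : ∀ x, ‖a x‖ < 1) (hb : ‖b‖ < 1) (hc : ‖c‖ < 1)
    (hd : ‖d‖ < 1) (hz1 : ∀ x, ‖z x‖ = 1) :
    Continuous fun x => awWeightZ (z x) (a x) b c d q := by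
  have hz0 : ∀ x, z x ≠ 0 := fun x => norm_ne_zero_iff.1 (by simp [hz1 x])
  have hpair {s : X → ℂ} (hs : Continuous s) := continuous_qPochInfPair hq hs hz hz0
  simp only [awWeightZ_eq_div_qPochInfPair]
  refine Continuous.div (by fun_prop (disch := assumption))
    ((((hpair ha).mul (hpair continuous_const)).mul (hpair continuous_const)).mul
      (hpair continuous_const)) fun x => ?_
  simp only [ne_eq, mul_eq_zero, qPochInfPair_ne_zero hq, ha1 x, hb, hc, hd, hz1 x, or_self,
    not_false_eq_true]

theorem continuousOn_awWeightZ (hq : ‖q‖ < 1) (ha : ‖a‖ < 1) (hb : ‖b‖ < 1) (hc : ‖c‖ < 1)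
    (hd : ‖d‖ < 1) : ContinuousOn (fun z => awWeightZ z a b c d q) (sphere 0 1) :=
  continuousOn_iff_continuous_domRestrict.2 <| continuous_awWeightZ hq continuous_const
    continuous_subtype_val (fun _ => ha) hb hc hd fun z => mem_sphere_zero_iff_norm.1 z.2

theorem circleAverage_congr_of_norm_eq_one {E : Type*} [NormedAddCommGroup E] [NormedSpace ℝ E]
    {f g : ℂ → E} (h : ∀ z, ‖z‖ = 1 → f z = g z) : circleAverage f 0 1 = circleAverage g 0 1 :=
  Real.circleAverage_congr_sphere fun z hz => h z (by simpa using hz)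

theorem circleAverage_const_mul (k : ℂ) (f : ℂ → ℂ) :
    circleAverage (fun z => k * f z) 0 1 = k * circleAverage f 0 1 :=
  Real.circleAverage_fun_smul (a := k) (f := f)

theorem circleAverage_norm_eq {E : Type*} [NormedAddCommGroup E] [NormedSpace ℝ E]
    (f : ℂ → E) (u : ℂ) :
    circleAverage f 0 ‖u‖ = circleAverage (fun z => f (u * z)) 0 1 := by
  rw [Real.circleAverage_eq_integral_add u.arg, Real.circleAverage_def]
  refine congrArg _ (intervalIntegral.integral_congr fun θ _ => congrArg f ?_)
  conv_rhs => rw [← Complex.norm_mul_exp_arg_mul_I u]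
  simp only [circleMap, Complex.ofReal_add, add_mul, Complex.exp_add, Complex.ofReal_one]
  ring

theorem circleAverage_eq_circleAverage_mul {f : ℂ → ℂ} (hq0 : q ≠ 0) (hq : ‖q‖ < 1)
    (hf : ∀ z, ‖q‖ ≤ ‖z‖ → ‖z‖ ≤ 1 → DifferentiableAt ℂ f z) :
    circleAverage f 0 1 = circleAverage (fun z => f (q * z)) 0 1 := by
  have hq' : 0 < ‖q‖ := norm_pos_iff.2 hq0
  rw [← circleAverage_norm_eq, Real.circleAverage_eq_circleIntegral one_ne_zero,
    Real.circleAverage_eq_circleIntegral hq'.ne',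
    Complex.circleIntegral_sub_center_inv_smul_eq_of_differentiable_on_annulus_off_countable
      hq' hq.le Set.countable_empty]
  · intro z hz
    exact (hf z (by simpa using hz.2) (by simpa using hz.1)).continuousAt.continuousWithinAt
  · intro z hz
    simp only [Set.sdiff_empty, Set.mem_sdiff, Metric.mem_ball, Metric.mem_closedBall,
      dist_zero_right, not_le] at hz
    exact hf z hz.2.le hz.1.le

/-- The product `(s z, s q z⁻¹; q)_∞`, the modification of `qPochInfPair` for which `z ↦ q z` has
the same effect as `z ↦ z⁻¹`. -/
def qThetaPair (s z q : ℂ) : ℂ := qPochInf (s * z) q * qPochInf (s * q * z⁻¹) q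

theorem qThetaPair_mul (hq0 : q ≠ 0) (s z : ℂ) : qThetaPair s (q * z) q = qThetaPair s z⁻¹ q := by
  have h : s * q * (q * z)⁻¹ = s * z⁻¹ := by field_simp
  rw [qThetaPair, qThetaPair, h, inv_inv, mul_assoc s q z, mul_comm]

theorem qPochInfPair_eq_mul_qThetaPair (hq : ‖q‖ < 1) (s z : ℂ) :
    qPochInfPair s z q = (1 - s * z⁻¹) * qThetaPair s z q := by
  rw [qPochInfPair, qThetaPair, qPochInf_eq_one_sub_mul hq (s * z⁻¹), mul_right_comm s]
  ring

theorem differentiableAt_qThetaPair (hq : ‖q‖ < 1) (s : ℂ) (hz : z ≠ 0) :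
    DifferentiableAt ℂ (fun z => qThetaPair s z q) z := by
  unfold qThetaPair
  fun_prop (disch := assumption)

theorem qThetaPair_ne_zero (hq : ‖q‖ < 1) (ha : ‖a‖ < 1) (hqz : ‖q‖ ≤ ‖z‖) (hz : ‖z‖ ≤ 1) :
    qThetaPair a z q ≠ 0 := by
  have hqz' : ‖q * z⁻¹‖ ≤ 1 := by
    rw [norm_mul, norm_inv, ← div_eq_mul_inv]
    exact div_le_one_of_le₀ hqz (norm_nonneg z)
  exact mul_ne_zero (qPochInf_ne_zero hq (norm_mul_lt_one ha hz))
    (qPochInf_ne_zero hq (mul_assoc a q z⁻¹ ▸ norm_mul_lt_one ha hqz'))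

/-- The Askey–Wilson weight modified to satisfy `F (q z) = -F z⁻¹`. By Cauchy's theorem its
average over the unit circle vanishes, which is a contiguous relation for the Askey–Wilson
integral. -/
def awTwistedWeight (a b c d q z : ℂ) : ℂ :=
  z * qThetaPair 1 (z ^ 2) q /
    (qThetaPair a z q * qThetaPair b z q * qThetaPair c z q * qThetaPair d z q)

theorem awTwistedWeight_mul (hq0 : q ≠ 0) (hq : ‖q‖ < 1) (a b c d : ℂ) (hz : z ≠ 0) :
    awTwistedWeight a b c d q (q * z) = -awTwistedWeight a b c d q z⁻¹ := by
  have hshift : q * z * qThetaPair 1 ((q * z) ^ 2) q = -(z⁻¹ * qThetaPair 1 (z⁻¹ ^ 2) q) := by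
    simp only [qThetaPair, one_mul]
    have h₁ := qPochInf_eq_one_sub_mul hq (q * (z ^ 2))
    have h₂ := qPochInf_eq_one_sub_mul hq (q * ((q * z) ^ 2)⁻¹)
    rw [show q * z ^ 2 * q = (q * z) ^ 2 by ring] at h₁
    rw [show q * ((q * z) ^ 2)⁻¹ * q = z⁻¹ ^ 2 by field_simp] at h₂
    rw [inv_pow z 2, inv_inv, h₁, h₂, inv_pow]
    field_simp
    ring
  rw [awTwistedWeight, awTwistedWeight, hshift, neg_div]
  simp only [qThetaPair_mul hq0]

theorem differentiableAt_awTwistedWeight (hq0 : q ≠ 0) (hq : ‖q‖ < 1) (ha : ‖a‖ < 1) (hb : ‖b‖ < 1)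
    (hc : ‖c‖ < 1) (hd : ‖d‖ < 1) (hqz : ‖q‖ ≤ ‖z‖) (hz : ‖z‖ ≤ 1) :
    DifferentiableAt ℂ (awTwistedWeight a b c d q) z := by
  have hz0 : z ≠ 0 := norm_pos_iff.1 ((norm_pos_iff.2 hq0).trans_le hqz)
  have hpair (s : ℂ) := differentiableAt_qThetaPair hq s hz0
  have hsq : DifferentiableAt ℂ (fun z => qThetaPair 1 (z ^ 2) q) z :=
    (differentiableAt_qThetaPair hq 1 (pow_ne_zero 2 hz0)).comp z (differentiableAt_pow 2)
  refine (differentiableAt_id.mul hsq).div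
    ((((hpair a).mul (hpair b)).mul (hpair c)).mul (hpair d)) ?_
  simp only [ne_eq, mul_eq_zero, qThetaPair_ne_zero hq, ha, hb, hc, hd, hqz, hz,
    or_self, not_false_eq_true]

theorem circleAverage_awTwistedWeight (hq0 : q ≠ 0) (hq : ‖q‖ < 1) (ha : ‖a‖ < 1) (hb : ‖b‖ < 1)
    (hc : ‖c‖ < 1) (hd : ‖d‖ < 1) : circleAverage (awTwistedWeight a b c d q) 0 1 = 0 := by
  refine self_eq_neg.1 ?_
  calc circleAverage (awTwistedWeight a b c d q) 0 1
      = circleAverage (fun z => awTwistedWeight a b c d q (q * z)) 0 1 :=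
        circleAverage_eq_circleAverage_mul hq0 hq fun z hqz hz =>
          differentiableAt_awTwistedWeight hq0 hq ha hb hc hd hqz hz
    _ = circleAverage (fun z => -1 * awTwistedWeight a b c d q z⁻¹) 0 1 :=
        circleAverage_congr_of_norm_eq_one fun z hz => by
          rw [awTwistedWeight_mul hq0 hq a b c d (norm_ne_zero_iff.1 (by simp [hz])), neg_one_mul]
    _ = -circleAverage (awTwistedWeight a b c d q) 0 1 := by
        rw [circleAverage_const_mul, Real.circleAverage_zero_one_congr_inv, neg_one_mul]

/-- The Askey–Wilson weight divided by its double zeros `(1 - z²) (1 - z⁻²)` at `z = ±1`. -/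
def awReducedWeight (z a b c d q : ℂ) : ℂ :=
  qPochInf (z ^ 2 * q) q * qPochInf (z⁻¹ ^ 2 * q) q /
    (qPochInfPair a z q * qPochInfPair b z q * qPochInfPair c z q * qPochInfPair d z q)

theorem awReducedWeight_inv (z a b c d q : ℂ) :
    awReducedWeight z⁻¹ a b c d q = awReducedWeight z a b c d q := by
  simp only [awReducedWeight, qPochInfPair_inv, inv_inv,
    mul_comm (qPochInf (z⁻¹ ^ 2 * q) q)]

theorem awWeightZ_eq_mul_awReducedWeight (hq : ‖q‖ < 1) (z a b c d : ℂ) :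
    awWeightZ z a b c d q = (1 - z ^ 2) * (1 - z⁻¹ ^ 2) * awReducedWeight z a b c d q := by
  rw [awWeightZ_eq_div_qPochInfPair, awReducedWeight, qPochInf_eq_one_sub_mul hq (z ^ 2),
    qPochInf_eq_one_sub_mul hq (z⁻¹ ^ 2)]
  ring

theorem awTwistedWeight_eq_mul_awReducedWeight (hq : ‖q‖ < 1) (ha : ‖a‖ < 1) (hb : ‖b‖ < 1)
    (hc : ‖c‖ < 1) (hd : ‖d‖ < 1) (hz : ‖z‖ = 1) :
    awTwistedWeight a b c d q z = z * (1 - z ^ 2) * ((1 - a * z⁻¹) * (1 - b * z⁻¹) *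
      (1 - c * z⁻¹) * (1 - d * z⁻¹)) * awReducedWeight z a b c d q := by
  have hfactor {s : ℂ} (hs : ‖s‖ < 1) : 1 - s * z⁻¹ ≠ 0 ∧ qThetaPair s z q ≠ 0 :=
    mul_ne_zero_iff.1 (qPochInfPair_eq_mul_qThetaPair hq s z ▸ qPochInfPair_ne_zero hq hs hz)
  obtain ⟨ha₁, ha₂⟩ := hfactor ha
  obtain ⟨hb₁, hb₂⟩ := hfactor hb
  obtain ⟨hc₁, hc₂⟩ := hfactor hc
  obtain ⟨hd₁, hd₂⟩ := hfactor hd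
  have hsq : qThetaPair 1 (z ^ 2) q =
      (1 - z ^ 2) * qPochInf (z ^ 2 * q) q * qPochInf (z⁻¹ ^ 2 * q) q := by
    rw [qThetaPair, one_mul, one_mul, qPochInf_eq_one_sub_mul hq (z ^ 2), inv_pow, mul_comm q]
  simp only [awTwistedWeight, awReducedWeight, qPochInfPair_eq_mul_qThetaPair hq _ z, hsq]
  generalize qThetaPair a z q = A at *
  generalize qThetaPair b z q = B at *
  generalize qThetaPair c z q = C at *
  generalize qThetaPair d z q = D at *
  generalize 1 - a * z⁻¹ = A' at *
  generalize 1 - b * z⁻¹ = B' at *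
  generalize 1 - c * z⁻¹ = C' at *
  generalize 1 - d * z⁻¹ = D' at *
  field_simp

theorem mul_awTwistedWeight_add_inv (hq : ‖q‖ < 1) (ha : ‖a‖ < 1) (hb : ‖b‖ < 1) (hc : ‖c‖ < 1)
    (hd : ‖d‖ < 1) (hz : ‖z‖ = 1) :
    a * (awTwistedWeight a b c d q z + awTwistedWeight a b c d q z⁻¹) =
      (1 - a * b) * (1 - a * c) * (1 - a * d) * awWeightZ z a b c d q -
        (1 - a * b * c * d) * awWeightZ z (a * q) b c d q := by
  have hz0 : z ≠ 0 := norm_ne_zero_iff.1 (by simp [hz])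
  have hshift : awWeightZ z (a * q) b c d q =
      (1 - a * z) * (1 - a * z⁻¹) * awWeightZ z a b c d q := by
    simpa [qPochPair, qPoch] using awWeightZ_mul_pow hq ha hz b c d 1
  rw [hshift, awWeightZ_eq_mul_awReducedWeight hq,
    awTwistedWeight_eq_mul_awReducedWeight hq ha hb hc hd hz,
    awTwistedWeight_eq_mul_awReducedWeight hq ha hb hc hd (by simp [hz]), awReducedWeight_inv,
    inv_inv]
  field_simp
  ring

/-- The Askey–Wilson integral `(2π)⁻¹ ∫ w(cos θ; a, b, c, d | q) dθ` over a period, as the average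
of the weight over the unit circle. -/
def awCircleAverage (a b c d q : ℂ) : ℂ := circleAverage (fun z => awWeightZ z a b c d q) 0 1

theorem awCircleAverage_rotate (a b c d q : ℂ) :
    awCircleAverage a b c d q = awCircleAverage b c d a q :=
  congrArg (circleAverage · 0 1) (funext fun z => awWeightZ_rotate z a b c d q)

theorem awCircleAverage_mul (hq0 : q ≠ 0) (hq : ‖q‖ < 1) (ha : ‖a‖ < 1) (hb : ‖b‖ < 1)
    (hc : ‖c‖ < 1) (hd : ‖d‖ < 1) :
    (1 - a * b * c * d) * awCircleAverage (a * q) b c d q =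
      (1 - a * b) * (1 - a * c) * (1 - a * d) * awCircleAverage a b c d q := by
  have hzero : circleAverage (fun z => a * (awTwistedWeight a b c d q z +
      awTwistedWeight a b c d q z⁻¹)) 0 1 = 0 := by
    have hcont : ContinuousOn (awTwistedWeight a b c d q) (sphere 0 1) := fun z hz => by
      have hz1 : ‖z‖ = 1 := by simpa using hz
      exact (differentiableAt_awTwistedWeight hq0 hq ha hb hc hd
        (hq.le.trans_eq hz1.symm) hz1.le).continuousAt.continuousWithinAt
    have hcont_inv : ContinuousOn (fun z => awTwistedWeight a b c d q z⁻¹) (sphere 0 1) :=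
      hcont.comp (continuousOn_inv₀.mono fun z hz => by
        simpa using norm_ne_zero_iff.1 (by simp_all : ‖z‖ ≠ 0)) fun z hz => by simp_all
    rw [circleAverage_const_mul, Real.circleAverage_fun_add (hcont.circleIntegrable zero_le_one)
      (hcont_inv.circleIntegrable zero_le_one), Real.circleAverage_zero_one_congr_inv,
      circleAverage_awTwistedWeight hq0 hq ha hb hc hd, add_zero, mul_zero]
  have hint {s : ℂ} (hs : ‖s‖ < 1) (k : ℂ) :
      CircleIntegrable (fun z => k * awWeightZ z s b c d q) 0 1 :=
    ((continuousOn_awWeightZ hq hs hb hc hd).const_mul k).circleIntegrable zero_le_one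
  rw [circleAverage_congr_of_norm_eq_one fun z hz =>
      mul_awTwistedWeight_add_inv hq ha hb hc hd hz,
    Real.circleAverage_fun_sub (hint ha _) (hint (norm_mul_lt_one ha hq.le) _),
    circleAverage_const_mul, circleAverage_const_mul] at hzero
  exact (sub_eq_zero.1 hzero).symm

theorem awCircleAverage_mul_pow (hq0 : q ≠ 0) (hq : ‖q‖ < 1) (ha : ‖a‖ < 1) (hb : ‖b‖ < 1)
    (hc : ‖c‖ < 1) (hd : ‖d‖ < 1) (n : ℕ) :
    qPoch (a * b * c * d) q n * awCircleAverage (a * q ^ n) b c d q =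
      qPoch (a * b) q n * qPoch (a * c) q n * qPoch (a * d) q n * awCircleAverage a b c d q := by
  induction n with
  | zero => simp only [qPoch_zero, pow_zero, mul_one]
  | succ n ih =>
    have hstep := awCircleAverage_mul hq0 hq (norm_mul_pow_lt_one hq ha n) hb hc hd
    rw [mul_assoc a (q ^ n) q, ← pow_succ] at hstep
    simp only [qPoch_succ]
    linear_combination qPoch (a * b * c * d) q n * hstep +
      (1 - a * b * q ^ n) * (1 - a * c * q ^ n) * (1 - a * d * q ^ n) * ih

theorem continuousOn_awCircleAverage (hq : ‖q‖ < 1) (hb : ‖b‖ < 1) (hc : ‖c‖ < 1)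
    (hd : ‖d‖ < 1) : ContinuousOn (fun a => awCircleAverage a b c d q) (ball 0 1) := by
  refine continuousOn_iff_continuous_domRestrict.2 <|
    (intervalIntegral.continuous_parametric_intervalIntegral_of_continuous' ?_ _ _).const_smul _
  exact continuous_awWeightZ (X := ball (0 : ℂ) 1 × ℝ) hq (by fun_prop) (by fun_prop)
    (fun p => mem_ball_zero_iff.1 p.1.2) hb hc hd fun p => by simp

theorem awCircleAverage_tendsto (hq : ‖q‖ < 1) (a : ℂ) (hb : ‖b‖ < 1) (hc : ‖c‖ < 1)
    (hd : ‖d‖ < 1) :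
    Tendsto (fun n : ℕ => awCircleAverage (a * q ^ n) b c d q) atTop
      (𝓝 (awCircleAverage 0 b c d q)) := by
  have hpow : Tendsto (fun n : ℕ => a * q ^ n) atTop (𝓝 0) := by
    simpa only [mul_zero] using (tendsto_pow_atTop_nhds_zero_of_norm_lt_one hq).const_mul a
  have hcont := (continuousOn_awCircleAverage hq hb hc hd).continuousAt
    (Metric.ball_mem_nhds 0 one_pos)
  exact hcont.tendsto.comp hpow

theorem awCircleAverage_zero_left (hq0 : q ≠ 0) (hq : ‖q‖ < 1) (ha : ‖a‖ < 1) (hb : ‖b‖ < 1)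
    (hc : ‖c‖ < 1) (hd : ‖d‖ < 1) :
    qPochInf (a * b * c * d) q * awCircleAverage 0 b c d q =
      qPochInf (a * b) q * qPochInf (a * c) q * qPochInf (a * d) q *
        awCircleAverage a b c d q := by
  have hlim {x : ℂ} := qPochInf_tendsto x q hq
  refine tendsto_nhds_unique (hlim.mul (awCircleAverage_tendsto hq a hb hc hd)) ?_
  simp only [awCircleAverage_mul_pow hq0 hq ha hb hc hd]
  exact ((hlim.mul hlim).mul hlim).mul_const _

theorem qPochInf_mul_awCircleAverage_zero (hq0 : q ≠ 0) (hq : ‖q‖ < 1) (ha : ‖a‖ < 1)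
    (hb : ‖b‖ < 1) (hc : ‖c‖ < 1) (hd : ‖d‖ < 1) :
    qPochInf (a * b * c * d) q * awCircleAverage 0 0 0 0 q =
      qPochInf (a * b) q * qPochInf (a * c) q * qPochInf (a * d) q * qPochInf (b * c) q *
        qPochInf (b * d) q * qPochInf (c * d) q * awCircleAverage a b c d q := by
  have h0 : ‖(0 : ℂ)‖ < 1 := by simp
  have ha' := awCircleAverage_zero_left hq0 hq ha hb hc hd
  have hb' := awCircleAverage_zero_left hq0 hq hb hc hd h0
  have hc' := awCircleAverage_zero_left hq0 hq hc hd h0 h0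
  have hd' := awCircleAverage_zero_left hq0 hq hd h0 h0 h0
  simp only [mul_zero, qPochInf_zero, one_mul, mul_one,
    awCircleAverage_rotate 0 _ _ _ q] at ha' hb' hc' hd'
  rw [hd', hc', hb']
  linear_combination qPochInf (b * c) q * qPochInf (b * d) q * qPochInf (c * d) q * ha'

theorem awReducedWeight_of_sq_eq {r : ℂ} (hq : ‖q‖ < 1) (hr : r ^ 2 = q) (hz : ‖z‖ = 1) :
    awReducedWeight z q (-q) r (-r) q = 1 := by
  have hr1 : ‖r‖ < 1 := by
    rwa [← hr, norm_pow, sq_lt_one_iff₀ (norm_nonneg r)] at hq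
  have hsplit (u : ℂ) : qPochInf (u ^ 2 * q) q = qPochInf (q * u) q * qPochInf (-q * u) q *
      (qPochInf (r * u) q * qPochInf (-r * u) q) := by
    rw [qPochInf_even_mul_odd hq, neg_mul, neg_mul, ← qPochInf_sq hq, ← qPochInf_sq hq]
    simp only [mul_pow, hr]
    ring_nf
  have hne {s : ℂ} (hs : ‖s‖ < 1) := qPochInfPair_ne_zero hq hs hz
  rw [awReducedWeight, hsplit z, hsplit z⁻¹, div_eq_one_iff_eq]
  · simp only [qPochInfPair]
    ring
  · simp only [ne_eq, mul_eq_zero, hne, norm_neg, hq, hr1, or_self, not_false_eq_true]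

theorem circleAverage_one_sub_sq :
    circleAverage (fun z : ℂ => (1 - z ^ 2) * (1 - z⁻¹ ^ 2)) 0 1 = 2 := by
  have hsq : circleAverage (fun z : ℂ => 1 - z ^ 2) 0 1 = 1 := by
    simpa using (show Differentiable ℂ fun z : ℂ => 1 - z ^ 2 by fun_prop).diffContOnCl
      |>.circleAverage (c := 0) (R := 1)
  have hcont : ContinuousOn (fun z : ℂ => 1 - z ^ 2) (sphere 0 1) := by fun_prop
  have hcont_inv : ContinuousOn (fun z : ℂ => 1 - z⁻¹ ^ 2) (sphere 0 1) :=
    continuousOn_const.sub ((continuousOn_inv₀.mono fun z hz =>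
      ne_zero_of_mem_unit_sphere ⟨z, hz⟩).pow 2)
  calc circleAverage (fun z : ℂ => (1 - z ^ 2) * (1 - z⁻¹ ^ 2)) 0 1
      = circleAverage (fun z : ℂ => (1 - z ^ 2) + (1 - z⁻¹ ^ 2)) 0 1 :=
        circleAverage_congr_of_norm_eq_one fun z hz => by
          have hz0 : z ≠ 0 := norm_ne_zero_iff.1 (by simp [hz])
          field_simp
          ring
    _ = 1 + 1 := by
        rw [Real.circleAverage_fun_add (hcont.circleIntegrable zero_le_one)
          (hcont_inv.circleIntegrable zero_le_one),
          Real.circleAverage_zero_one_congr_inv (f := fun z => 1 - z ^ 2), hsq]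
    _ = 2 := one_add_one_eq_two

theorem awCircleAverage_zero (hq0 : q ≠ 0) (hq : ‖q‖ < 1) :
    qPochInf q q * awCircleAverage 0 0 0 0 q = 2 := by
  obtain ⟨r, hr⟩ := IsAlgClosed.exists_pow_nat_eq q two_pos
  have hr1 : ‖r‖ < 1 := by
    rwa [← hr, norm_pow, sq_lt_one_iff₀ (norm_nonneg r)] at hq
  have heval : awCircleAverage q (-q) r (-r) q = 2 := by
    rw [awCircleAverage, ← circleAverage_one_sub_sq]
    refine circleAverage_congr_of_norm_eq_one fun z hz => ?_
    rw [awWeightZ_eq_mul_awReducedWeight hq, awReducedWeight_of_sq_eq hq hr hz, mul_one]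
  have hodd : qPochInf (q * r) q * qPochInf (q * -r) q = qPochInf (q * q ^ 2) (q ^ 2) := by
    rw [mul_neg, ← qPochInf_sq hq, mul_pow, hr, mul_comm q]
  have hred := qPochInf_mul_awCircleAverage_zero hq0 hq hq (by rwa [norm_neg] : ‖-q‖ < 1) hr1
    (by rwa [norm_neg] : ‖-r‖ < 1)
  rw [heval, show q * -q * r * -r = q * q * q by rw [← hr]; ring,
    show r * -r = -q by rw [← hr]; ring, show -q * r = q * -r by ring,
    show -q * -r = q * r by ring] at hred
  have hneg : qPochInf (-q) q = (1 + q) * qPochInf (q * -q) q := by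
    rw [qPochInf_eq_one_sub_mul hq, sub_neg_eq_add, neg_mul, mul_neg]
  calc qPochInf q q * awCircleAverage 0 0 0 0 q
      = (1 - q) * (1 - q * q) * (qPochInf (q * q * q) q * awCircleAverage 0 0 0 0 q) := by
        rw [qPochInf_eq_one_sub_mul hq q, qPochInf_eq_one_sub_mul hq (q * q)]
        ring
    _ = (1 - q) * (1 - q * q) * (qPochInf (q * -q) q * qPochInf (-q) q *
          (qPochInf (q * r) q * qPochInf (q * -r) q) ^ 2 * 2) := by
        rw [hred]
        ring
    _ = (qPochInf (-q) q * qPochInf q (q ^ 2)) ^ 2 * 2 := by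
        rw [hodd, qPochInf_eq_one_sub_mul (norm_sq_lt_one hq) q, hneg]
        ring
    _ = 2 := by rw [qPochInf_neg_mul_qPochInf_sq hq, one_pow, one_mul]

theorem awCircleAverage_eq (hq0 : q ≠ 0) (hq : ‖q‖ < 1) (ha : ‖a‖ < 1) (hb : ‖b‖ < 1)
    (hc : ‖c‖ < 1) (hd : ‖d‖ < 1) :
    awCircleAverage a b c d q = 2 * qPochInf (a * b * c * d) q /
      (qPochInf q q * qPochInf (a * b) q * qPochInf (a * c) q * qPochInf (a * d) q *
        qPochInf (b * c) q * qPochInf (b * d) q * qPochInf (c * d) q) := by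
  have hne {s t : ℂ} (hs : ‖s‖ < 1) (ht : ‖t‖ < 1) : qPochInf (s * t) q ≠ 0 :=
    qPochInf_ne_zero hq (norm_mul_lt_one hs ht.le)
  rw [eq_div_iff (by
    simp only [ne_eq, mul_eq_zero, hne, ha, hb, hc, hd, qPochInf_ne_zero hq hq, or_self,
      not_false_eq_true])]
  linear_combination qPochInf (a * b * c * d) q * awCircleAverage_zero hq0 hq -
    qPochInf q q * qPochInf_mul_awCircleAverage_zero hq0 hq ha hb hc hd

theorem qPoch_mul_qPochInf_inv (hq : ‖q‖ < 1) (ha : ‖a‖ < 1) (n : ℕ) :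
    qPoch a q n * (qPochInf a q)⁻¹ = (qPochInf (a * q ^ n) q)⁻¹ := by
  have := qPoch_ne_zero hq ha n
  rw [qPochInf_eq_qPoch_mul hq a n]
  field_simp

theorem qPoch_mul_qPochInf_mul_pow_inv (hq : ‖q‖ < 1) (ha : ‖a‖ < 1) (j l : ℕ) :
    qPoch (a * q ^ j) q l * (qPochInf (a * q ^ j) q)⁻¹ = (qPochInf (a * q ^ (j + l)) q)⁻¹ := by
  rw [qPoch_mul_qPochInf_inv hq (norm_mul_pow_lt_one hq ha j), mul_assoc, ← pow_add]

theorem continuousOn_qPochPair (s q : ℂ) (n : ℕ) :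
    ContinuousOn (fun z => qPochPair s z q n) (sphere 0 1) := by
  have hz0 : ∀ z ∈ sphere (0 : ℂ) 1, z ≠ 0 := fun z hz => Metric.ne_of_mem_sphere hz one_ne_zero
  exact ((continuous_qPoch q n).comp_continuousOn (by fun_prop)).mul
    ((continuous_qPoch q n).comp_continuousOn (continuousOn_const.mul (continuousOn_inv₀.mono hz0)))

theorem continuousOn_askeyWilsonZ (n : ℕ) (a b c d q : ℂ) :
    ContinuousOn (fun z => askeyWilsonZ n z a b c d q) (sphere 0 1) := by
  simp only [askeyWilsonZ_eq_sum_antidiagonal]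
  exact continuousOn_const.mul (continuousOn_finsetSum _ fun p _ =>
    continuousOn_const.mul (continuousOn_qPochPair a q p.1))

theorem circleAverage_askeyWilsonZ_mul (n : ℕ) (a b c d q : ℂ) {g : ℂ → ℂ}
    (hg : ContinuousOn g (sphere 0 1)) :
    circleAverage (fun z => askeyWilsonZ n z a b c d q * g z) 0 1 =
      (a ^ n)⁻¹ * ∑ p ∈ antidiagonal n, awCoeff q a b c d p.1 p.2 *
        circleAverage (fun z => qPochPair a z q p.1 * g z) 0 1 := by
  simp only [askeyWilsonZ_eq_sum_antidiagonal, mul_assoc, Finset.sum_mul,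
    circleAverage_const_mul]
  rw [Real.circleAverage_fun_sum (f := fun (p : ℕ × ℕ) z => awCoeff q a b c d p.1 p.2 *
    (qPochPair a z q p.1 * g z)) fun p _ => ContinuousOn.circleIntegrable zero_le_one
    (continuousOn_const.mul ((continuousOn_qPochPair a q p.1).mul hg))]
  simp only [circleAverage_const_mul]

theorem circleAverage_qPochPair_mul_awWeightZ (hq : ‖q‖ < 1) (ha : ‖a‖ < 1) (b c d : ℂ) (n : ℕ) :
    circleAverage (fun z => qPochPair a z q n * awWeightZ z a b c d q) 0 1 =
      awCircleAverage (a * q ^ n) b c d q :=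
  circleAverage_congr_of_norm_eq_one fun _ hz => (awWeightZ_mul_pow hq ha hz b c d n).symm

theorem awCoeff_mul_awCircleAverage (hq0 : q ≠ 0) (hq : ‖q‖ < 1) (ha : ‖a‖ < 1) (hb : ‖b‖ < 1)
    (hc : ‖c‖ < 1) (hd : ‖d‖ < 1) (e : ℂ) (j l : ℕ) :
    awCoeff q a b c e j l * awCircleAverage (a * q ^ j) b c d q =
      2 * qPochInf (a * b * c * d * q ^ (j + l)) q /
        (qPochInf q q * qPochInf (a * b * q ^ (j + l)) q * qPochInf (a * c * q ^ (j + l)) q *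
          qPochInf (a * d) q * qPochInf (b * c) q * qPochInf (b * d) q * qPochInf (c * d) q) *
      (terminatingCoeff q j l *
        (qPoch (a * d) q j * qPoch (q ^ (((j + l : ℕ) : ℤ) - 1) * a * b * c * e) q j) *
        (qPoch (a * e * q ^ j) q l * qPoch (a * b * c * d * q ^ j) q l)) := by
  have hab := qPoch_mul_qPochInf_mul_pow_inv hq (norm_mul_lt_one ha hb.le) j l
  have hac := qPoch_mul_qPochInf_mul_pow_inv hq (norm_mul_lt_one ha hc.le) j l
  have had := qPoch_mul_qPochInf_inv hq (norm_mul_lt_one ha hd.le) j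
  have habcd := qPochInf_eq_qPoch_mul hq (a * b * c * d * q ^ j) l
  rw [mul_assoc _ (q ^ j), ← pow_add] at habcd
  rw [awCircleAverage_eq hq0 hq (norm_mul_pow_lt_one hq ha j) hb hc hd, awCoeff,
    mul_right_comm a (q ^ j) b, mul_right_comm a (q ^ j) c, mul_right_comm a (q ^ j) d,
    mul_right_comm (a * b) (q ^ j) c, mul_right_comm (a * b * c) (q ^ j) d, habcd]
  simp only [div_eq_mul_inv, mul_inv, ← hab, ← hac, ← had]
  ring

theorem circleAverage_askeyWilsonZ_mul_awWeightZ (hq0 : q ≠ 0) (hq : ‖q‖ < 1) (k : ℕ)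
    (ha0 : a ≠ 0) (hd0 : d ≠ 0) (ha : ‖a‖ < 1) (hb : ‖b‖ < 1) (hc : ‖c‖ < 1) (hd : ‖d‖ < 1)
    (e : ℂ) :
    circleAverage (fun z => askeyWilsonZ k z a b c e q * awWeightZ z a b c d q) 0 1 =
      2 * d ^ k * qPoch (e / d) q k * qPochInf (a * b * c * d * q ^ k) q /
        (qPochInf q q * qPochInf (a * b * q ^ k) q * qPochInf (a * c * q ^ k) q *
          qPochInf (b * c * q ^ k) q * qPochInf (a * d) q * qPochInf (b * d) q *
          qPochInf (c * d) q) := by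
  have hsaal := sum_terminatingCoeff_saalschutz hq0 hq (A := a * d)
    (B := q ^ ((k : ℤ) - 1) * a * b * c * e) (α := e / d) (β := b * c) k
    (mul_ne_zero ha0 hd0) (by
      rw [zpow_sub_one₀ hq0, zpow_natCast]
      field_simp)
  have hbc := qPoch_ne_zero hq (norm_mul_lt_one hb hc.le) k
  have hterm : ∀ p ∈ antidiagonal k, awCoeff q a b c e p.1 p.2 *
      circleAverage (fun z => qPochPair a z q p.1 * awWeightZ z a b c d q) 0 1 =
      2 * qPochInf (a * b * c * d * q ^ k) q /
        (qPochInf q q * qPochInf (a * b * q ^ k) q * qPochInf (a * c * q ^ k) q *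
          qPochInf (a * d) q * qPochInf (b * c) q * qPochInf (b * d) q * qPochInf (c * d) q) *
      (terminatingCoeff q p.1 p.2 *
        (qPoch (a * d) q p.1 * qPoch (q ^ ((k : ℤ) - 1) * a * b * c * e) q p.1) *
        (qPoch (a * d * (e / d) * q ^ p.1) q p.2 *
          qPoch (a * d * (b * c) * q ^ p.1) q p.2)) := by
    intro p hp
    rw [circleAverage_qPochPair_mul_awWeightZ hq ha,
      awCoeff_mul_awCircleAverage hq0 hq ha hb hc hd, mem_antidiagonal.1 hp,
      show a * d * (e / d) = a * e by field_simp, show a * d * (b * c) = a * b * c * d by ring]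
  rw [circleAverage_askeyWilsonZ_mul k a b c e q (continuousOn_awWeightZ hq ha hb hc hd),
    Finset.sum_congr rfl hterm, ← Finset.mul_sum, hsaal, qPochInf_eq_qPoch_mul hq (b * c) k,
    mul_pow]
  field_simp

/-- The integrand of `awIntegral` without the factor `1 / √(1 - x²)`, as a function of `z`. -/
def awProductZ (n k : ℕ) (a b c d e f q z : ℂ) : ℂ :=
  askeyWilsonZ n z a b c d q * askeyWilsonZ k z a b e f q * awWeightZ z a b c f q

theorem awProductZ_inv (n k : ℕ) (a b c d e f q z : ℂ) :
    awProductZ n k a b c d e f q z⁻¹ = awProductZ n k a b c d e f q z := by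
  simp only [awProductZ, askeyWilsonZ_inv, awWeightZ_inv]

theorem continuousOn_awProductZ (n k : ℕ) (d e : ℂ) {f : ℂ} (hq : ‖q‖ < 1) (ha : ‖a‖ < 1)
    (hb : ‖b‖ < 1) (hc : ‖c‖ < 1) (hf : ‖f‖ < 1) :
    ContinuousOn (awProductZ n k a b c d e f q) (sphere 0 1) :=
  ((continuousOn_askeyWilsonZ n a b c d q).mul (continuousOn_askeyWilsonZ k a b e f q)).mul
    (continuousOn_awWeightZ hq ha hb hc hf)

theorem circleAverage_qPochPair_mul_askeyWilsonZ_mul_awWeightZ (hq0 : q ≠ 0) (hq : ‖q‖ < 1)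
    (k : ℕ) {f : ℂ} (ha0 : a ≠ 0) (hc0 : c ≠ 0) (ha : ‖a‖ < 1) (hb : ‖b‖ < 1) (hc : ‖c‖ < 1)
    (hf : ‖f‖ < 1) (e : ℂ) (j : ℕ) :
    circleAverage (fun z => qPochPair c z q j *
        (askeyWilsonZ k z a b e f q * awWeightZ z a b c f q)) 0 1 =
      2 * c ^ k * (qPoch (e / (c * q ^ j)) q k * (q ^ j) ^ k) *
          qPochInf (a * b * c * f * q ^ (k + j)) q /
        (qPochInf q q * qPochInf (a * b * q ^ k) q * qPochInf (a * f * q ^ k) q *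
          qPochInf (b * f * q ^ k) q * qPochInf (a * c * q ^ j) q * qPochInf (b * c * q ^ j) q *
          qPochInf (c * f * q ^ j) q) := by
  have hweight : ∀ z, ‖z‖ = 1 → qPochPair c z q j *
      (askeyWilsonZ k z a b e f q * awWeightZ z a b c f q) =
        askeyWilsonZ k z a b f e q * awWeightZ z a b f (c * q ^ j) q := by
    intro z hz
    rw [← awWeightZ_rotate z (c * q ^ j), awWeightZ_mul_pow hq hc hz, awWeightZ_rotate z c,
      awWeightZ_swap z a b f, askeyWilsonZ_swap_last k z a b f]
    ring
  rw [circleAverage_congr_of_norm_eq_one hweight, circleAverage_askeyWilsonZ_mul_awWeightZ hq0 hq k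
    ha0 (mul_ne_zero hc0 (pow_ne_zero j hq0)) ha hb hf (norm_mul_pow_lt_one hq hc j)]
  ring_nf

theorem qPoch_div_mul_pow_mul (hq0 : q ≠ 0) {e : ℂ} (hc : c ≠ 0) (he : e ≠ 0) {j k : ℕ}
    (hne : qPoch (q ^ (1 - (k : ℤ)) * (c / e)) q j ≠ 0) :
    qPoch (e / (c * q ^ j)) q k * (q ^ j) ^ k =
      qPoch (e / c) q k * (qPoch (q * c / e) q j / qPoch (q ^ (1 - (k : ℤ)) * (c / e)) q j) := by
  have hshift := qPoch_div_pow hq0 (div_ne_zero he hc) j k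
  rw [div_div, show q / (e / c * q ^ k) = q ^ (1 - (k : ℤ)) * (c / e) by
    rw [zpow_sub₀ hq0, zpow_one, zpow_natCast]; field_simp,
    show q / (e / c) = q * c / e by field_simp] at hshift
  rw [← mul_div_assoc, eq_div_iff hne, ← hshift]
  ring

theorem awCoeff_mul_circleAverage (hq0 : q ≠ 0) (hq : ‖q‖ < 1) (k : ℕ) {e f : ℂ}
    (ha0 : a ≠ 0) (hc0 : c ≠ 0) (he0 : e ≠ 0) (ha : ‖a‖ < 1) (hb : ‖b‖ < 1) (hc : ‖c‖ < 1)
    (hf : ‖f‖ < 1) {j l : ℕ} (hcd : qPoch (c * d) q j ≠ 0)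
    (hce : qPoch (q ^ (1 - (k : ℤ)) * (c / e)) q j ≠ 0) :
    awCoeff q c b a d j l * circleAverage (fun z => qPochPair c z q j *
        (askeyWilsonZ k z a b e f q * awWeightZ z a b c f q)) 0 1 =
      2 * c ^ k * qPoch (c * d) q (j + l) * qPoch (e / c) q k * qPochInf (a * b * c * f * q ^ k) q /
        (qPochInf q q * qPochInf (a * b * q ^ k) q * qPochInf (a * f * q ^ k) q *
          qPochInf (b * f * q ^ k) q * qPochInf (a * c * q ^ (j + l)) q *
          qPochInf (b * c * q ^ (j + l)) q * qPochInf (c * f) q) *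
      (terminatingCoeff q j l * (qPoch (q ^ (((j + l : ℕ) : ℤ) - 1) * a * b * c * d) q j *
        qPoch (c * f) q j * qPoch (q * c / e) q j / (qPoch (c * d) q j *
          qPoch (a * b * c * f * q ^ k) q j * qPoch (q ^ (1 - (k : ℤ)) * (c / e)) q j))) := by
  have hac := qPoch_mul_qPochInf_mul_pow_inv hq (norm_mul_lt_one ha hc.le) j l
  have hbc := qPoch_mul_qPochInf_mul_pow_inv hq (norm_mul_lt_one hb hc.le) j l
  have hcf := qPoch_mul_qPochInf_inv hq (norm_mul_lt_one hc hf.le) j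
  have habcf : qPochInf (a * b * c * f * q ^ k) q * (qPoch (a * b * c * f * q ^ k) q j)⁻¹ =
      qPochInf (a * b * c * f * q ^ (k + j)) q := by
    rw [qPochInf_eq_qPoch_mul hq _ j, pow_add, ← mul_assoc]
    have := qPoch_ne_zero hq (norm_mul_pow_lt_one hq (norm_mul_lt_one (norm_mul_lt_one
      (norm_mul_lt_one ha hb.le) hc.le) hf.le) k) j
    field_simp
  have hcd' : qPoch (c * d) q (j + l) * (qPoch (c * d) q j)⁻¹ = qPoch (c * d * q ^ j) q l := by
    rw [qPoch_add, mul_comm, inv_mul_cancel_left₀ hcd]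
  rw [circleAverage_qPochPair_mul_askeyWilsonZ_mul_awWeightZ hq0 hq k ha0 hc0 ha hb hc hf, awCoeff,
    show q ^ (((j + l : ℕ) : ℤ) - 1) * c * b * a * d =
      q ^ (((j + l : ℕ) : ℤ) - 1) * a * b * c * d by ring, mul_comm c b, mul_comm c a, ← hcd',
    ← habcf, qPoch_div_mul_pow_mul hq0 hc0 he0 hce]
  simp only [div_eq_mul_inv, mul_inv, ← hac, ← hbc, ← hcf]
  ring

theorem circleAverage_awProductZ (hq0 : q ≠ 0) (hq : ‖q‖ < 1) (n k : ℕ) {e f : ℂ} (ha0 : a ≠ 0)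
    (hc0 : c ≠ 0) (he0 : e ≠ 0) (ha : ‖a‖ < 1) (hb : ‖b‖ < 1) (hc : ‖c‖ < 1) (hf : ‖f‖ < 1)
    (hcd : qPoch (c * d) q n ≠ 0) (hce : qPoch (q ^ (1 - (k : ℤ)) * (c / e)) q n ≠ 0) :
    circleAverage (awProductZ n k a b c d e f q) 0 1 =
      (c ^ n)⁻¹ * (2 * c ^ k * qPoch (c * d) q n * qPoch (e / c) q k *
        qPochInf (a * b * c * f * q ^ k) q /
        (qPochInf q q * qPochInf (a * b * q ^ k) q * qPochInf (a * f * q ^ k) q *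
          qPochInf (b * f * q ^ k) q * qPochInf (a * c * q ^ n) q * qPochInf (b * c * q ^ n) q *
          qPochInf (c * f) q) *
      phi43 (q ^ (-(n : ℤ))) (q ^ ((n : ℤ) - 1) * a * b * c * d) (c * f) (q * c / e) (c * d)
        (a * b * c * f * q ^ k) (q ^ (1 - (k : ℤ)) * (c / e)) q q) := by
  have hswap : ∀ z, ‖z‖ = 1 → awProductZ n k a b c d e f q z =
      askeyWilsonZ n z c b a d q * (askeyWilsonZ k z a b e f q * awWeightZ z a b c f q) := by
    intro z hz
    have hz0 : z ≠ 0 := norm_ne_zero_iff.1 (hz ▸ one_ne_zero)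
    rw [awProductZ, askeyWilsonZ_swap hq0 hq n b d hz0 ha0 hc0, mul_assoc]
  rw [circleAverage_congr_of_norm_eq_one hswap, circleAverage_askeyWilsonZ_mul n c b a d q
    (g := fun z => askeyWilsonZ k z a b e f q * awWeightZ z a b c f q)
    ((continuousOn_askeyWilsonZ k a b e f q).mul (continuousOn_awWeightZ hq ha hb hc hf)),
    phi43_eq_sum_antidiagonal hq0, Finset.mul_sum (antidiagonal n) _ (_ / _)]
  refine congrArg ((c ^ n)⁻¹ * ·) (Finset.sum_congr rfl ?_)
  rintro ⟨j, l⟩ hp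
  obtain rfl : j + l = n := mem_antidiagonal.1 hp
  rw [qPoch_add] at hcd hce
  exact awCoeff_mul_circleAverage hq0 hq k ha0 hc0 he0 ha hb hc hf (left_ne_zero_of_mul hcd)
    (left_ne_zero_of_mul hce)

section Integral

variable {E : Type*} [NormedAddCommGroup E] [NormedSpace ℝ E]

theorem circleAverage_eq_integral_zero_pi {g : ℂ → E} (hg : ContinuousOn g (sphere 0 1))
    (hinv : ∀ z, g z⁻¹ = g z) :
    circleAverage g 0 1 = Real.pi⁻¹ • ∫ θ in 0..Real.pi, g (circleMap 0 1 θ) := by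
  have hcont : Continuous fun θ : ℝ => g (circleMap 0 1 θ) :=
    hg.comp_continuous (continuous_circleMap 0 1) fun θ => circleMap_mem_sphere 0 zero_le_one θ
  have hupper : ∫ θ in Real.pi..2 * Real.pi, g (circleMap 0 1 θ) =
      ∫ θ in 0..Real.pi, g (circleMap 0 1 θ) := by
    have hreflect := intervalIntegral.integral_comp_sub_left (a := Real.pi) (b := 2 * Real.pi)
      (fun θ => g (circleMap 0 1 θ)) (2 * Real.pi)
    rw [sub_self, two_mul, add_sub_cancel_right, ← two_mul] at hreflect
    rw [← hreflect]
    refine intervalIntegral.integral_congr fun θ _ => ?_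
    rw [← hinv, circleMap_zero_inv, inv_one, sub_eq_neg_add, periodic_circleMap]
  rw [Real.circleAverage_def, ← intervalIntegral.integral_add_adjacent_intervals
    (hcont.intervalIntegrable 0 Real.pi) (hcont.intervalIntegrable _ _), hupper, ← two_smul ℝ,
    smul_smul, mul_inv_rev, inv_mul_cancel_right₀ two_ne_zero]

theorem intervalIntegrable_inv_sqrt_smul_comp_arccos {g : ℝ → E} (hg : Continuous g) :
    IntervalIntegrable (fun x : ℝ => (√(1 - x ^ 2))⁻¹ • g (Real.arccos x))
      MeasureTheory.volume (-1) 1 := by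
  have hsqrt := Polynomial.Chebyshev.intervalIntegrable_sqrt_one_sub_sq_inv
  simp only [Real.sqrt_inv] at hsqrt
  exact hsqrt.smul_continuousOn (hg.comp Real.continuous_arccos).continuousOn

theorem integral_inv_sqrt_smul_comp_arccos (g : ℝ → E) :
    ∫ x in (-1 : ℝ)..1, (√(1 - x ^ 2))⁻¹ • g (Real.arccos x) = ∫ θ in 0..Real.pi, g θ := by
  have hsubst := intervalIntegral.integral_deriv_smul_comp_of_deriv_nonpos (a := -1) (b := 1)
    (g := g) (f' := fun x => -(1 / √(1 - x ^ 2))) Real.continuous_arccos.continuousOn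
    (fun x hx => Real.hasDerivAt_arccos (by aesop) (by aesop))
    (fun x _ => neg_nonpos.2 (by positivity))
  rw [Real.arccos_one, Real.arccos_neg_one, intervalIntegral.integral_symm 0] at hsubst
  simpa [intervalIntegral.integral_neg] using hsubst

end Integral

theorem apply_zOf_eq_apply_circleMap {α : Type*} {g : ℂ → α} (hinv : ∀ z, g z⁻¹ = g z)
    {x : ℝ} (hx : x ∈ Set.Icc (-1 : ℝ) 1) : g (zOf x) = g (circleMap 0 1 (Real.arccos x)) := by
  have hcos :
      (circleMap 0 1 (Real.arccos x) + (circleMap 0 1 (Real.arccos x))⁻¹) / 2 = (x : ℂ) := by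
    conv_rhs => rw [← Real.cos_arccos hx.1 hx.2, Complex.ofReal_cos, Complex.cos]
    simp [circleMap, Complex.exp_neg]
  rcases zOf_eq (circleMap 0 1 (Real.arccos x)) (circleMap_ne_center one_ne_zero) with h | h <;>
    rw [hcos] at h <;> rw [h]
  exact hinv _

theorem awIntegrand_eq (n k : ℕ) (a b c d e f q : ℂ) {x : ℝ} (hx : x ∈ Set.Icc (-1 : ℝ) 1) :
    awIntegrand n k a b c d e f q x =
      (√(1 - x ^ 2))⁻¹ • awProductZ n k a b c d e f q (circleMap 0 1 (Real.arccos x)) := by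
  rw [← apply_zOf_eq_apply_circleMap (awProductZ_inv n k a b c d e f q) hx, Complex.real_smul,
    Complex.ofReal_inv, ← div_eq_inv_mul]
  rfl

theorem continuous_awProductZ_circleMap (n k : ℕ) (d e : ℂ) {f : ℂ} (hq : ‖q‖ < 1) (ha : ‖a‖ < 1)
    (hb : ‖b‖ < 1) (hc : ‖c‖ < 1) (hf : ‖f‖ < 1) :
    Continuous fun θ : ℝ => awProductZ n k a b c d e f q (circleMap 0 1 θ) :=
  (continuousOn_awProductZ n k d e hq ha hb hc hf).comp_continuous (continuous_circleMap 0 1)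
    fun θ => circleMap_mem_sphere 0 zero_le_one θ

theorem intervalIntegrable_awIntegrand (n k : ℕ) (d e : ℂ) {f : ℂ} (hq : ‖q‖ < 1) (ha : ‖a‖ < 1)
    (hb : ‖b‖ < 1) (hc : ‖c‖ < 1) (hf : ‖f‖ < 1) :
    IntervalIntegrable (awIntegrand n k a b c d e f q) MeasureTheory.volume (-1) 1 := by
  refine (intervalIntegrable_inv_sqrt_smul_comp_arccos
    (continuous_awProductZ_circleMap n k d e hq ha hb hc hf)).congr fun x hx => ?_
  rw [Set.uIoc_of_le (by norm_num)] at hx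
  exact (awIntegrand_eq n k a b c d e f q (Set.Ioc_subset_Icc_self hx)).symm

theorem awIntegral_eq_circleAverage (n k : ℕ) (d e : ℂ) {f : ℂ} (hq : ‖q‖ < 1) (ha : ‖a‖ < 1)
    (hb : ‖b‖ < 1) (hc : ‖c‖ < 1) (hf : ‖f‖ < 1) :
    awIntegral n k a b c d e f q =
      Real.pi * circleAverage (awProductZ n k a b c d e f q) 0 1 := by
  have hcongr : awIntegral n k a b c d e f q = ∫ x in (-1 : ℝ)..1,
      (√(1 - x ^ 2))⁻¹ • awProductZ n k a b c d e f q (circleMap 0 1 (Real.arccos x)) :=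
    intervalIntegral.integral_congr fun x hx => awIntegrand_eq n k a b c d e f q
      (by rwa [Set.uIcc_of_le (by norm_num)] at hx)
  rw [hcongr, integral_inv_sqrt_smul_comp_arccos
      fun θ => awProductZ n k a b c d e f q (circleMap 0 1 θ),
    circleAverage_eq_integral_zero_pi (continuousOn_awProductZ n k d e hq ha hb hc hf)
      (awProductZ_inv n k a b c d e f q),
    Complex.real_smul, Complex.ofReal_inv,
    mul_inv_cancel_left₀ (Complex.ofReal_ne_zero.2 Real.pi_ne_zero)]

theorem awIntegral_symm (n k : ℕ) (a b c d e f q : ℂ) :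
    awIntegral n k a b c d e f q = awIntegral k n a b f e d c q := by
  unfold awIntegral awIntegrand askeyWilson awWeight
  congr 1 with x
  rw [askeyWilsonZ_swap_last n, askeyWilsonZ_swap_last k, awWeightZ_swap]
  ring

theorem phi43_eq_awIntegral (hq0 : q ≠ 0) (hq : ‖q‖ < 1) (n k : ℕ) {e f : ℂ} (ha0 : a ≠ 0)
    (hc0 : c ≠ 0) (he0 : e ≠ 0) (ha : ‖a‖ < 1) (hb : ‖b‖ < 1) (hc : ‖c‖ < 1) (hf : ‖f‖ < 1)
    (hcd : qPoch (c * d) q n ≠ 0) (hec : qPoch (e / c) q k ≠ 0)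
    (hce : qPoch (q ^ (1 - (k : ℤ)) * (c / e)) q n ≠ 0) :
    phi43 (q ^ (-(n : ℤ))) (q ^ ((n : ℤ) - 1) * a * b * c * d) (c * f) (q * c / e)
        (c * d) (q ^ k * a * b * c * f) (q ^ (1 - (k : ℤ)) * (c / e)) q q =
      c ^ ((n : ℤ) - (k : ℤ)) *
        ((qPochInf q q * qPochInf (c * f) q * qPochInf (q ^ n * a * c) q *
            qPochInf (q ^ n * b * c) q * qPochInf (q ^ k * a * b) q *
            qPochInf (q ^ k * a * f) q * qPochInf (q ^ k * b * f) q) /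
          (2 * (Real.pi : ℂ) * qPoch (c * d) q n * qPoch (e / c) q k *
            qPochInf (q ^ k * a * b * c * f) q)) *
        awIntegral n k a b c d e f q := by
  have hne {s t : ℂ} (hs : ‖s‖ < 1) (ht : ‖t‖ < 1) (m : ℕ) : qPochInf (s * t * q ^ m) q ≠ 0 :=
    qPochInf_ne_zero hq (norm_mul_pow_lt_one hq (norm_mul_lt_one hs ht.le) m)
  have hpi : (Real.pi : ℂ) ≠ 0 := Complex.ofReal_ne_zero.2 Real.pi_ne_zero
  have := hne ha hc n
  have := hne hb hc n
  have := hne ha hb k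
  have := hne ha hf k
  have := hne hb hf k
  have := hne (norm_mul_lt_one (norm_mul_lt_one ha hb.le) hc.le) hf k
  have := qPochInf_ne_zero hq hq
  have := qPochInf_ne_zero hq (norm_mul_lt_one hc hf.le)
  rw [awIntegral_eq_circleAverage n k d e hq ha hb hc hf,
    circleAverage_awProductZ hq0 hq n k ha0 hc0 he0 ha hb hc hf hcd hce, zpow_sub₀ hc0,
    zpow_natCast, zpow_natCast]
  simp only [mul_assoc (q ^ _), mul_comm (q ^ _) (_ * _)]
  field_simp

theorem corollary7p2_general (n k : ℕ) (hq0 : q ≠ 0) (hq : ‖q‖ < 1) {e f : ℂ}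
    (ha : a ≠ 0) (hc : c ≠ 0) (hd : d ≠ 0) (he : e ≠ 0) (hf : f ≠ 0)
    (ha1 : ‖a‖ < 1) (hb1 : ‖b‖ < 1) (hc1 : ‖c‖ < 1) (hf1 : ‖f‖ < 1) :
    IntervalIntegrable (awIntegrand n k a b c d e f q) MeasureTheory.volume (-1) 1 ∧
    (qPoch (c * d) q n ≠ 0 → qPoch (e / c) q k ≠ 0 →
      qPoch (q ^ (1 - (k : ℤ)) * (c / e)) q n ≠ 0 →
      phi43 (q ^ (-(n : ℤ))) (q ^ ((n : ℤ) - 1) * a * b * c * d) (c * f) (q * c / e)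
          (c * d) (q ^ k * a * b * c * f) (q ^ (1 - (k : ℤ)) * (c / e)) q q =
        c ^ ((n : ℤ) - (k : ℤ)) *
          ((qPochInf q q * qPochInf (c * f) q * qPochInf (q ^ n * a * c) q *
              qPochInf (q ^ n * b * c) q * qPochInf (q ^ k * a * b) q *
              qPochInf (q ^ k * a * f) q * qPochInf (q ^ k * b * f) q) /
            (2 * (Real.pi : ℂ) * qPoch (c * d) q n * qPoch (e / c) q k *
              qPochInf (q ^ k * a * b * c * f) q)) *
          awIntegral n k a b c d e f q) ∧
    (qPoch (e * f) q k ≠ 0 → qPoch (d / f) q n ≠ 0 →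
      qPoch (q ^ (1 - (n : ℤ)) * (f / d)) q k ≠ 0 →
      phi43 (q ^ (-(k : ℤ))) (q ^ ((k : ℤ) - 1) * a * b * e * f) (c * f) (q * f / d)
          (e * f) (q ^ n * a * b * c * f) (q ^ (1 - (n : ℤ)) * (f / d)) q q =
        f ^ ((k : ℤ) - (n : ℤ)) *
          ((qPochInf q q * qPochInf (c * f) q * qPochInf (q ^ n * a * b) q *
              qPochInf (q ^ n * a * c) q * qPochInf (q ^ n * b * c) q *
              qPochInf (q ^ k * a * f) q * qPochInf (q ^ k * b * f) q) /
            (2 * (Real.pi : ℂ) * qPoch (d / f) q n * qPoch (e * f) q k *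
              qPochInf (q ^ n * a * b * c * f) q)) *
          awIntegral n k a b c d e f q) := by
  refine ⟨intervalIntegrable_awIntegrand n k d e hq ha1 hb1 hc1 hf1,
    phi43_eq_awIntegral hq0 hq n k ha hc he ha1 hb1 hc1 hf1, fun hef hdf hfd => ?_⟩
  have hsymm := phi43_eq_awIntegral hq0 hq k n ha hf hd ha1 hb1 hf1 hc1
    (by rwa [mul_comm f e]) hdf hfd
  rw [mul_right_comm _ f e, mul_right_comm _ f c, mul_comm f c, mul_comm f e,
    ← awIntegral_symm] at hsymm
  rw [hsymm]
  ring

end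

theorem corollary7p2 (n k : ℕ) (q : ℝ) (hq0 : 0 < q) (hq1 : q < 1) (a b c d e f : ℂ)
    (ha : a ≠ 0) (hb : b ≠ 0) (hc : c ≠ 0) (hd : d ≠ 0) (he : e ≠ 0) (hf : f ≠ 0)
    (ha1 : ‖a‖ < 1) (hb1 : ‖b‖ < 1) (hc1 : ‖c‖ < 1) (hf1 : ‖f‖ < 1) :
    IntervalIntegrable (awIntegrand n k a b c d e f q) MeasureTheory.volume (-1) 1 ∧
    (qPoch (c * d) q n ≠ 0 → qPoch (e / c) q k ≠ 0 →
      qPoch ((q : ℂ) ^ (1 - (k : ℤ)) * (c / e)) q n ≠ 0 →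
      phi43 ((q : ℂ) ^ (-(n : ℤ))) ((q : ℂ) ^ ((n : ℤ) - 1) * a * b * c * d) (c * f) (q * c / e)
          (c * d) ((q : ℂ) ^ k * a * b * c * f) ((q : ℂ) ^ (1 - (k : ℤ)) * (c / e)) q q =
        c ^ ((n : ℤ) - (k : ℤ)) *
          ((qPochInf q q * qPochInf (c * f) q * qPochInf ((q : ℂ) ^ n * a * c) q *
              qPochInf ((q : ℂ) ^ n * b * c) q * qPochInf ((q : ℂ) ^ k * a * b) q *
              qPochInf ((q : ℂ) ^ k * a * f) q * qPochInf ((q : ℂ) ^ k * b * f) q) /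
            (2 * (Real.pi : ℂ) * qPoch (c * d) q n * qPoch (e / c) q k *
              qPochInf ((q : ℂ) ^ k * a * b * c * f) q)) *
          awIntegral n k a b c d e f q) ∧
    (qPoch (e * f) q k ≠ 0 → qPoch (d / f) q n ≠ 0 →
      qPoch ((q : ℂ) ^ (1 - (n : ℤ)) * (f / d)) q k ≠ 0 →
      phi43 ((q : ℂ) ^ (-(k : ℤ))) ((q : ℂ) ^ ((k : ℤ) - 1) * a * b * e * f) (c * f) (q * f / d)
          (e * f) ((q : ℂ) ^ n * a * b * c * f) ((q : ℂ) ^ (1 - (n : ℤ)) * (f / d)) q q =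
        f ^ ((k : ℤ) - (n : ℤ)) *
          ((qPochInf q q * qPochInf (c * f) q * qPochInf ((q : ℂ) ^ n * a * b) q *
              qPochInf ((q : ℂ) ^ n * a * c) q * qPochInf ((q : ℂ) ^ n * b * c) q *
              qPochInf ((q : ℂ) ^ k * a * f) q * qPochInf ((q : ℂ) ^ k * b * f) q) /
            (2 * (Real.pi : ℂ) * qPoch (d / f) q n * qPoch (e * f) q k *
              qPochInf ((q : ℂ) ^ n * a * b * c * f) q)) *
          awIntegral n k a b c d e f q) :=
  corollary7p2_general n k (by exact_mod_cast hq0.ne') (by simpa [abs_of_pos hq0] using hq1)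
    ha hc hd he hf ha1 hb1 hc1 hf1
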